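/- Let $\xi$ be a probability measure on $\{0,1,2,\dots\}$ with $\sum_k k\,\xi(k)\le 1$ and, for each $k\ge 1$, let $\eta^{(k)}$ be a probability measure on $\{-1,0,1\}^k$ (with $\eta^{(0)}(\varnothing)=1$). A labelled tree is a finite rooted plane tree $t$ with a label $\ell_t(v)\in\mathbb Z$ at each vertex $v$, such that labels change by $-1$, $0$ or $1$ along edges; edges are oriented away from the root, and $|t|$ denotes the number of edges. For $x\in\mathbb Z$ let $\Pi_x$ be the law of the labelled Galton--Watson tree rooted at label $x$, which gives a labelled tree $t$ with root label $x$ the mass $\prod_{v}\xi(k_t(v))\,\eta^{(k_t(v))}([v]_t)$, where $k_t(v)$ is the number of children of $v$ and $[v]_t$ is the vector of label increments from $v$ to its children, from left to right. Let $\Pi^+$ be the law of the tree obtained from a tree with law $\Pi_1$ by deleting all vertices that have a strict ancestor with label $0$, and let $n_\tau$ be the number of vertices with label $0$ in $\tau$. Fix $V\ge 1$ with $\Pi_0(|T|=V)>0$, and let $\Pi_0^{(V)}=\Pi_0(\,\cdot\mid |T|=V)$. For $m\ge 1$ let $\bar{\mathcal X}_m=(X_m^+,X_m^-,M_m^-)$,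 where $X_m^+$ (resp. $X_m^-$) is the number of edges of $T$ from a vertex labelled $m-1$ to a vertex labelled $m$ (resp. from $m$ to $m-1$), and $M_m^-$ is the number of edges whose endpoints both have label at most $m-1$. For integers $p,q,v\ge 0$ let $$H(p,q,v)=\mathbb P\Big(\sum_{k=1}^p|\tau_k|=V-v-p\ \Big|\ \sum_{k=1}^p n_{\tau_k}=q\Big),$$ where $\tau_1,\dots,\tau_p$ are independent with law $\Pi^+$ (with $H=0$ if the conditioning event has probability zero). Then there is a transition kernel $P$ on $\mathbb N_{\ge 0}^3$ such that: 1. under $\Pi_0$, the process $(\bar{\mathcal X}_m)_{m\ge 1}$ is a time-homogeneous Markov chain with transition kernel $P$; 2. for all $m\ge1$ and all $x$ with $\Pi_0(\bar{\mathcal X}_m=x)>0$, one has $H(x)=\Pi_0(|T|=V\mid \bar{\mathcal X}_m=x)$ and $\sum_y P(x,y)H(y)=H(x)$; 3. for all $m\ge1$ and all $x$ with $\Pi_0^{(V)}(\bar{\mathcal X}_m=x)>0$, one has $H(x)>0$; 4. under $\Pi_0^{(V)}$, the process $(\bar{\mathcal X}_m)_{m\ge 1}$ is a time-homogeneous Markov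 chain, with transition kernel the $h$-transform $$P^{(V)}(x,y)=\frac{H(y)}{H(x)}\,P(x,y).$$ Here "Markov chain with transition kernel $K$" means: for all $m\ge1$ and all $x_1,\dots,x_m,y$ such that $\{\bar{\mathcal X}_1=x_1,\dots,\bar{\mathcal X}_m=x_m\}$ has positive probability, the conditional probability of $\{\bar{\mathcal X}_{m+1}=y\}$ given this event is $K(x_m,y)$. -/

import Mathlib

open MeasureTheory ProbabilityTheory
open scoped ENNReal

/-- Finite rooted plane trees with an integer label at each vertex: `node a cs` is the tree whose
root has label `a` and whose subtrees branching off the children of the root are, from left to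
right, the entries of `cs`. (That labels vary by `-1`, `0` or `1` along edges is imposed by the
displacement laws, which give weight zero to all other trees.) -/
inductive LTree : Type
  | node (a : ℤ) (cs : List LTree) : LTree

namespace LTree

/-- Every set of trees is measurable (there are countably many trees). -/
instance : MeasurableSpace LTree := ⊤

/-- The label of the root. -/
def rootLabel : LTree → ℤ
  | node a _ => a

/-- The list of the labels of all vertices. -/
def labels : LTree → List ℤ
  | node a cs => a :: cs.flatMap fun c => c.labels

/-- The list of all edges, oriented away from the root; an edge is recorded as the pair
(label of the parent, label of the child). -/
def edges : LTree → List (ℤ × ℤ)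
  | node a cs => cs.flatMap fun c => (a, c.rootLabel) :: c.edges

/-- The number `|t|` of edges. -/
def size (t : LTree) : ℕ := t.edges.length

/-- The number `n_t` of vertices with label `0`. -/
def zeros (t : LTree) : ℕ := t.labels.count 0

/-- The truncation `t^{[l]}`: delete all vertices that have a strict ancestor with label `l`. -/
def trunc (l : ℤ) : LTree → LTree
  | node a cs => node a (if a = l then [] else cs.map fun c => c.trunc l)

/-- `X_m^+`: the number of edges from a vertex labelled `m - 1` to a vertex labelled `m`. -/
def up (m : ℕ) (t : LTree) : ℕ := t.edges.count ((m : ℤ) - 1, (m : ℤ))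

/-- `X_m^-`: the number of edges from a vertex labelled `m` to a vertex labelled `m - 1`. -/
def down (m : ℕ) (t : LTree) : ℕ := t.edges.count ((m : ℤ), (m : ℤ) - 1)

/-- `M_m^-`: the number of edges with both endpoints having label at most `m - 1`. -/
def massBelow (m : ℕ) (t : LTree) : ℕ :=
  t.edges.countP fun e => e.1 ≤ (m : ℤ) - 1 ∧ e.2 ≤ (m : ℤ) - 1

/-- The triple `(X_m^+, X_m^-, M_m^-)`. -/
def profile (m : ℕ) (t : LTree) : ℕ × ℕ × ℕ := (t.up m, t.down m, t.massBelow m)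

/-- `Π(t) = ∏_v ξ(k(v)) η^{(k(v))}([v])`, where `k(v)` is the number of children of the vertex `v`
and `[v]` is the vector of the label increments from `v` to its children. -/
noncomputable def weight (ξ : PMF ℕ) (η : (k : ℕ) → PMF (Fin k → ℤ)) : LTree → ℝ≥0∞
  | node a cs =>
    ξ cs.length * η cs.length (fun i => (cs.get i).rootLabel - a) *
      (cs.map fun c => c.weight ξ η).prod

end LTree

/-- `Π_x`: the law of the labelled Galton-Watson tree rooted at `x`, i.e. the restriction of the
measure with weights `Π(t)` to the trees with root label `x`. -/
noncomputable def treeLaw (ξ : PMF ℕ) (η : (k : ℕ) → PMF (Fin k → ℤ)) (x : ℤ) : Measure LTree :=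
  (Measure.sum fun t : LTree => t.weight ξ η • Measure.dirac t).restrict {t | t.rootLabel = x}

/-- `Π_0^{(V)}`: the law `Π_0` conditioned on having `V` edges. -/
noncomputable def sizedLaw (ξ : PMF ℕ) (η : (k : ℕ) → PMF (Fin k → ℤ)) (V : ℕ) : Measure LTree :=
  (treeLaw ξ η 0)[|{t | t.size = V}]

/-- `Π^+`: the law of the truncation `T^{[0]}` when `T` has law `Π_1`. -/
noncomputable def posExcursionLaw (ξ : PMF ℕ) (η : (k : ℕ) → PMF (Fin k → ℤ)) : Measure LTree :=
  (treeLaw ξ η 1).map (LTree.trunc 0)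

/-- `H(p, q, v) = ℙ(∑ |τ_k| = V - v - p ∣ ∑ n_{τ_k} = q)` for `p` independent positive tree
excursions `τ_k` with law `Π^+`. -/
noncomputable def harmonicH (ξ : PMF ℕ) (η : (k : ℕ) → PMF (Fin k → ℤ)) (V : ℕ) :
    ℕ × ℕ × ℕ → ℝ≥0∞
  | (p, q, v) =>
    (Measure.pi fun _ : Fin p => posExcursionLaw ξ η)[|{τ | ∑ k, (τ k).zeros = q}]
      {τ | ((∑ k, (τ k).size : ℕ) : ℤ) = (V : ℤ) - v - p}

/-- The process `(Y m)`, `m ≥ 1`, with values in a countable set, is under `μ` a (time-homogeneous)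
Markov chain with transition probabilities `K x y` from `x` to `y`: given any past of positive
probability up to time `m`, the next value is `y` with probability `K (Y m) y`. -/
def IsMarkovChainWith {Ω S : Type*} [MeasurableSpace Ω] (μ : Measure Ω) (Y : ℕ → Ω → S)
    (K : S → S → ℝ≥0∞) : Prop :=
  ∀ m : ℕ, 1 ≤ m → ∀ s : ℕ → S,
    μ {ω | ∀ k, 1 ≤ k → k ≤ m → Y k ω = s k} ≠ 0 →
      ∀ y : S, μ[|{ω | ∀ k, 1 ≤ k → k ≤ m → Y k ω = s k}] {ω | Y (m + 1) ω = y} = K (s m) y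

/-! Cut the tree at the edges between the labels `m - 1` and `m`. The pieces above the level are
excursions whose number is the number `p` of upward crossings, those below are excursions whose
number is one plus the number `q` of downward crossings, and each excursion spawns excursions of the
other kind at its exit points. If `E` and `F` are the generating series of the two kinds of
excursions, with a variable marking exit points and further ones marking edges, the series `U`, `D`
of the trees growing from an upward, respectively downward, crossing are the solution of a Lagrange
system `U = X E(D)`, `D = Y F(U)`. By Lagrange inversion the coefficient of `X ^ p Y ^ q` is
`[x ^ q] E ^ p` times a factor determined by the edges below the level. Hence, given `p` and `q`,
the edges above the level are independent of those below, and are distributed as those of `p`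
independent positive excursions conditioned to have `q` zeros in total.

Given the profile at level `m`, the earlier profiles are functions of the edges below the level,
while the next profile and the total size are functions of the edges above it. This gives the Markov
property and the function `H`, and conditioning on the size is an `h`-transform. -/

open Finset.HasAntidiagonal (antidiagonal mem_antidiagonal)

/-- Complete semirings in the sense of Eilenberg: arbitrary families are summable, and
multiplication distributes over their sums. In contrast to `IsTopologicalSemiring`, multiplication
is not required to be continuous, so that `ℝ≥0∞` is an example. -/
class IsCompleteSemiring (R : Type*) [CommSemiring R] [TopologicalSpace R] : Prop
    extends T3Space R, ContinuousAdd R where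
  summable {ι : Type} (f : ι → R) : Summable f
  mul_tsum {ι : Type} (a : R) (f : ι → R) : a * ∑' i, f i = ∑' i, a * f i

namespace IsCompleteSemiring

instance : IsCompleteSemiring ℝ≥0∞ where
  summable _ := ENNReal.summable
  mul_tsum _ _ := ENNReal.tsum_mul_left.symm

variable {R : Type*} [CommSemiring R] [TopologicalSpace R] [IsCompleteSemiring R] {ι κ : Type}

theorem tsum_mul (f : ι → R) (a : R) : (∑' i, f i) * a = ∑' i, f i * a := by
  simp only [mul_comm _ a, mul_tsum]

theorem tsum_comm (f : ι → κ → R) : ∑' i, ∑' j, f i j = ∑' j, ∑' i, f i j :=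
  Summable.tsum_comm' (summable _) (fun _ => summable _) fun _ => summable _

theorem tsum_prod (f : ι × κ → R) : ∑' x, f x = ∑' i, ∑' j, f (i, j) :=
  Summable.tsum_prod' (summable _) fun _ => summable _

theorem tsum_mul_tsum (f : ι → R) (g : κ → R) :
    (∑' i, f i) * ∑' j, g j = ∑' i, ∑' j, f i * g j := by
  rw [tsum_mul]
  simp only [mul_tsum]

theorem tsum_eq_tsum_fiber [DecidableEq κ] (h : ι → κ) (f : ι → R) :
    ∑' i, f i = ∑' j, ∑' i, if h i = j then f i else 0 := by
  rw [tsum_comm]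
  exact tsum_congr fun i => (tsum_ite_eq' (h i) fun _ => f i).symm

theorem tsum_sum_antidiagonal (f : ℕ → ℕ → R) :
    ∑' n, ∑ p ∈ antidiagonal n, f p.1 p.2 = ∑' i, ∑' j, f i j := by
  rw [← tsum_prod fun p : ℕ × ℕ => f p.1 p.2,
    ← Finset.HasAntidiagonal.sigmaAntidiagonalEquivProd.tsum_eq,
    Summable.tsum_sigma' (fun _ => summable _) (summable _)]
  exact tsum_congr fun n => (Finset.tsum_subtype (antidiagonal n) fun p => f p.1 p.2).symm

theorem tsum_list (f : List ι → R) : ∑' l, f l = f [] + ∑' i, ∑' l, f (i :: l) := by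
  let e : Unit ⊕ ι × List ι ≃ List ι :=
    { toFun := Sum.elim (fun _ => []) fun p => p.1 :: p.2
      invFun := fun l => l.casesOn (Sum.inl ()) fun i l => Sum.inr (i, l)
      left_inv := by rintro (_ | _) <;> rfl
      right_inv := by rintro (_ | _) <;> rfl }
  rw [← e.tsum_eq f, Summable.tsum_sum (summable _) (summable _), tsum_prod]
  exact congrArg (· + _)
    ((tsum_fintype (L := .unconditional Unit) fun _ => f []).trans (Fintype.sum_unique _))

theorem tsum_list_map_eq [DecidableEq κ] (h : ι → κ) (f : ι → R) (ls : List κ) :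
    ∑' cs : List ι, (if cs.map h = ls then (cs.map f).prod else 0) =
      (ls.map fun b => ∑' i, if h i = b then f i else 0).prod := by
  induction ls with
  | nil =>
    rw [tsum_list]
    simp
  | cons b ls ih =>
    rw [tsum_list, List.map_cons, List.prod_cons, ← ih, tsum_mul_tsum]
    simp only [List.map_nil, reduceCtorEq, if_false, zero_add, List.map_cons, List.cons.injEq,
      List.prod_cons, ite_and, ite_mul, mul_ite, zero_mul, mul_zero]
    refine tsum_congr fun i => tsum_congr fun l => ?_
    split_ifs <;> rfl

theorem tsum_pow (f : ι → R) (n : ℕ) : (∑' i, f i) ^ n = ∑' v : Fin n → ι, ∏ k, f (v k) := by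
  induction n with
  | zero =>
    rw [pow_zero, tsum_eq_single (fun k => k.elim0) fun v hv => absurd (Subsingleton.elim _ _) hv,
      Fin.prod_univ_zero]
  | succ n ih =>
    rw [pow_succ', ih, tsum_mul_tsum, ← (Fin.consEquiv fun _ => ι).tsum_eq, tsum_prod]
    simp only [Fin.consEquiv_apply, Fin.prod_univ_succ, Fin.cons_zero, Fin.cons_succ]

section MvPowerSeries

open scoped MvPowerSeries.WithPiTopology

variable {σ : Type*}

theorem coeff_tsum (N : σ →₀ ℕ) (f : ι → MvPowerSeries σ R) :
    MvPowerSeries.coeff N (∑' i, f i) = ∑' i, MvPowerSeries.coeff N (f i) :=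
  (((MvPowerSeries.WithPiTopology.summable_iff_summable_coeff).2 fun _ =>
    summable _).hasSum.map (MvPowerSeries.coeff N)
    (MvPowerSeries.WithPiTopology.continuous_coeff R N)).tsum_eq.symm

instance : IsCompleteSemiring (MvPowerSeries σ R) where
  toT3Space := inferInstanceAs (T3Space ((σ →₀ ℕ) → R))
  toContinuousAdd := inferInstanceAs (ContinuousAdd ((σ →₀ ℕ) → R))
  summable f := (MvPowerSeries.WithPiTopology.summable_iff_summable_coeff).2 fun _ => summable _
  mul_tsum a f := by
    classical
    ext N
    simp only [MvPowerSeries.coeff_mul, coeff_tsum, mul_tsum]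
    rw [Summable.tsum_finsetSum fun _ _ => summable _]

theorem coeff_tsum_monomial_pow (z : ι → ℕ) (f : ι → R) (p q : ℕ) :
    PowerSeries.coeff q ((∑' i, PowerSeries.monomial (z i) (f i)) ^ p) =
      ∑' v : Fin p → ι, if ∑ k, z (v k) = q then ∏ k, f (v k) else 0 := by
  classical
  rw [tsum_pow, PowerSeries.coeff, coeff_tsum]
  refine tsum_congr fun v => ?_
  rw [← PowerSeries.coeff, PowerSeries.prod_monomial, PowerSeries.coeff_monomial]
  simp only [eq_comm]

end MvPowerSeries

end IsCompleteSemiring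

section SumEval

open IsCompleteSemiring

variable {A A' B : Type*} [CommSemiring A] [CommSemiring A'] [CommSemiring B] [TopologicalSpace B]

/-- The value at `x` of a power series whose coefficients are read through `φ`, as an unconditional
sum. No convergence condition is needed in a complete semiring. -/
noncomputable def sumEval (φ : A →+* B) (F : PowerSeries A) (x : B) : B :=
  ∑' n, φ (PowerSeries.coeff n F) * x ^ n

theorem sumEval_map (φ : A →+* B) (ψ : A' →+* A) (F : PowerSeries A') (x : B) :
    sumEval φ (F.map ψ) x = sumEval (φ.comp ψ) F x := by
  simp only [sumEval, PowerSeries.coeff_map, RingHom.comp_apply]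

theorem sumEval_one (φ : A →+* B) (x : B) : sumEval φ 1 x = 1 := by
  rw [sumEval, tsum_eq_single 0 fun n hn => by simp [PowerSeries.coeff_one, hn]]
  simp

variable [IsCompleteSemiring B]

theorem sumEval_mul (φ : A →+* B) (F G : PowerSeries A) (x : B) :
    sumEval φ (F * G) x = sumEval φ F x * sumEval φ G x := by
  rw [sumEval, sumEval, sumEval, tsum_mul_tsum, ← tsum_sum_antidiagonal]
  refine tsum_congr fun n => ?_
  rw [PowerSeries.coeff_mul, map_sum, Finset.sum_mul]
  refine Finset.sum_congr rfl fun p hp => ?_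
  rw [map_mul, mul_mul_mul_comm, ← pow_add, mem_antidiagonal.1 hp]

theorem sumEval_pow (φ : A →+* B) (F : PowerSeries A) (x : B) (k : ℕ) :
    sumEval φ (F ^ k) x = sumEval φ F x ^ k := by
  induction k with
  | zero => rw [pow_zero, pow_zero, sumEval_one]
  | succ k ih => rw [pow_succ, pow_succ, sumEval_mul, ih]

end SumEval

section Lagrange

open PowerSeries

variable {A : Type*} [CommSemiring A]

theorem coeff_X_mul_derivative (F : PowerSeries A) (n : ℕ) :
    coeff n (X * derivative A F) = n * coeff n F := by
  cases n with
  | zero => simp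
  | succ n => rw [coeff_succ_X_mul, coeff_derivative, mul_comm, Nat.cast_succ]

-- The coefficient form of `(a + b) (F ^ a)' F ^ b = a (F ^ (a + b))'`.
theorem sum_antidiagonal_mul_coeff_pow (F : PowerSeries A) (a b n : ℕ) :
    ((a + b : ℕ) : A) * ∑ x ∈ antidiagonal n, x.1 * coeff x.1 (F ^ a) * coeff x.2 (F ^ b) =
      a * n * coeff n (F ^ (a + b)) := by
  have hderiv : ((a + b : ℕ) : PowerSeries A) * (X * derivative A (F ^ a) * F ^ b) =
      (a : PowerSeries A) * (X * derivative A (F ^ (a + b))) := by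
    cases a with
    | zero => simp
    | succ a =>
      rw [derivative_pow, derivative_pow, show a + 1 + b - 1 = a + b by omega,
        Nat.add_sub_cancel, pow_add]
      push_cast
      ring
  have hcoeff := congrArg (coeff n) hderiv
  rw [← map_natCast (C (R := A)), ← map_natCast (C (R := A)), coeff_C_mul, coeff_C_mul,
    coeff_X_mul_derivative, coeff_mul] at hcoeff
  simpa only [coeff_X_mul_derivative, mul_assoc] using hcoeff

theorem add_mul_sum_antidiagonal_coeff_pow (hA : ∀ n : ℕ, n ≠ 0 → IsUnit (n : A))
    (E F : PowerSeries A) (k P q : ℕ) :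
    ((k + P : ℕ) : A) * ∑ n ∈ antidiagonal q, ∑ j ∈ antidiagonal P,
        coeff n.1 (E ^ k) * coeff j.1 (F ^ n.1) *
          (j.1 * (coeff n.2 (E ^ P) * coeff j.2 (F ^ n.2))) =
      k * P * (coeff q (E ^ (k + P)) * coeff P (F ^ q)) := by
  rcases Nat.eq_zero_or_pos q with rfl | hq
  · rcases Nat.eq_zero_or_pos P with rfl | hP
    · simp
    · rw [Finset.sum_eq_zero, pow_zero F, coeff_one, if_neg hP.ne', mul_zero, mul_zero, mul_zero]
      simp only [Finset.HasAntidiagonal.antidiagonal_zero, Finset.mem_singleton, forall_eq,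
        pow_zero]
      refine Finset.sum_eq_zero fun j _ => ?_
      rcases Nat.eq_zero_or_pos j.1 with hj | hj
      · simp [hj]
      · simp [coeff_one, hj.ne']
  refine (hA q hq.ne').mul_left_cancel ?_
  have hF : ∀ n ∈ antidiagonal q, (q : A) * ∑ j ∈ antidiagonal P,
      coeff n.1 (E ^ k) * coeff j.1 (F ^ n.1) *
        (j.1 * (coeff n.2 (E ^ P) * coeff j.2 (F ^ n.2))) =
      P * coeff P (F ^ q) * (n.1 * coeff n.1 (E ^ k) * coeff n.2 (E ^ P)) := by
    intro n hn
    have hn := mem_antidiagonal.1 hn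
    calc
      _ = coeff n.1 (E ^ k) * coeff n.2 (E ^ P) * (((n.1 + n.2 : ℕ) : A) *
          ∑ j ∈ antidiagonal P, j.1 * coeff j.1 (F ^ n.1) * coeff j.2 (F ^ n.2)) := by
        rw [hn, mul_left_comm, Finset.mul_sum (a := _ * _)]
        congr 1
        exact Finset.sum_congr rfl fun j _ => by ring
      _ = _ := by
        rw [sum_antidiagonal_mul_coeff_pow, hn]
        ring
  calc
    _ = ((k + P : ℕ) : A) * ∑ n ∈ antidiagonal q,
        P * coeff P (F ^ q) * (n.1 * coeff n.1 (E ^ k) * coeff n.2 (E ^ P)) := by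
      rw [mul_left_comm, Finset.mul_sum, Finset.sum_congr rfl hF]
    _ = P * coeff P (F ^ q) * (k * q * coeff q (E ^ (k + P))) := by
      rw [← Finset.mul_sum, mul_left_comm, sum_antidiagonal_mul_coeff_pow]
    _ = _ := by ring

theorem add_mul_eq_of_lagrange_recursion (hA : ∀ n : ℕ, n ≠ 0 → IsUnit (n : A))
    (E F : PowerSeries A) {W : ℕ → ℕ → ℕ → A}
    (h_zero : ∀ p q, W 0 p q = if p = 0 ∧ q = 0 then 1 else 0)
    (h_rec : ∀ k P q, W k (k + P) q = ∑ n ∈ antidiagonal q, ∑ j ∈ antidiagonal P,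
      coeff n.1 (E ^ k) * coeff j.1 (F ^ n.1) * W j.1 P n.2) (k P q : ℕ) :
    ((k + P : ℕ) : A) * W k (k + P) q = k * (coeff q (E ^ (k + P)) * coeff P (F ^ q)) := by
  induction hp : k + P using Nat.strong_induction_on generalizing k P q with
  | _ p ih =>
  subst hp
  rcases Nat.eq_zero_or_pos P with rfl | hP
  · congr 1
    rw [h_rec, Finset.sum_eq_single (q, 0)]
    · simp [h_zero]
    · intro n hn hne
      have : n.2 ≠ 0 := fun h => hne (Prod.ext (by simpa [h] using mem_antidiagonal.1 hn) h)
      simp [h_zero, this]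
    · simp
  rcases Nat.eq_zero_or_pos k with rfl | hk
  · simp [h_zero, hP.ne']
  refine (hA P hP.ne').mul_left_cancel ?_
  rw [mul_left_comm, ← mul_assoc (P : A), mul_comm (P : A) k,
    ← add_mul_sum_antidiagonal_coeff_pow hA, h_rec, Finset.mul_sum]
  congr 1
  refine Finset.sum_congr rfl fun n _ => ?_
  rw [Finset.mul_sum]
  refine Finset.sum_congr rfl fun j hj => ?_
  have hj := mem_antidiagonal.1 hj
  have hjP := ih P (by omega) j.1 j.2 n.2 hj
  rw [mul_left_comm, hjP]

section System

open IsCompleteSemiring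
open scoped MvPowerSeries.WithPiTopology

theorem coeff_coeff_monomial_mul (k n p q : ℕ) (a : A) (s : PowerSeries (PowerSeries A)) :
    coeff q (coeff p (X ^ k * C X ^ n * (C (C a) * s))) =
      if k ≤ p ∧ n ≤ q then a * coeff (q - n) (coeff (p - k) s) else 0 := by
  rw [mul_assoc, coeff_X_pow_mul', ite_and]
  split_ifs with hk hn
  · rw [← map_pow, coeff_C_mul, coeff_X_pow_mul', if_pos hn, coeff_C_mul, coeff_C_mul]
  · rw [← map_pow, coeff_C_mul, coeff_X_pow_mul', if_neg hn]
  · rw [map_zero]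

variable [TopologicalSpace A] {E F : PowerSeries A} {U D : PowerSeries (PowerSeries A)}

theorem tsum_eq_sum_antidiagonal {f : ℕ → A} {q : ℕ} (hf : ∀ n, q < n → f n = 0) :
    ∑' n, f n = ∑ x ∈ antidiagonal q, f x.1 := by
  rw [Finset.Nat.sum_antidiagonal_eq_sum_range_succ_mk]
  exact tsum_eq_sum fun n hn => hf n (by simpa using hn)

theorem coeff_coeff_pow_of_lt (hU : U = X * sumEval (C.comp C) E D) {k p : ℕ} (hpk : p < k)
    (q : ℕ) : coeff q (coeff p (U ^ k)) = 0 := by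
  rw [hU, mul_pow, coeff_X_pow_mul', if_neg hpk.not_ge, map_zero]

variable [IsCompleteSemiring A]

theorem coeff_coeff_tsum {ι : Type} (p q : ℕ) (f : ι → PowerSeries (PowerSeries A)) :
    coeff q (coeff p (∑' i, f i)) = ∑' i, coeff q (coeff p (f i)) := by
  rw [coeff, coeff, coeff_tsum, coeff_tsum]

theorem coeff_coeff_pow_eq_tsum (hU : U = X * sumEval (C.comp C) E D)
    (hD : D = C X * sumEval (C.comp C) F U) (k p q : ℕ) :
    coeff q (coeff p (U ^ k)) = ∑' n, ∑' j, if k ≤ p ∧ n ≤ q then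
      coeff n (E ^ k) * coeff j (F ^ n) * coeff (q - n) (coeff (p - k) (U ^ j)) else 0 := by
  have hpow : U ^ k = ∑' n, ∑' j,
      X ^ k * C X ^ n * (C (C (coeff n (E ^ k) * coeff j (F ^ n))) * U ^ j) := by
    conv_lhs => rw [hU, mul_pow, ← sumEval_pow, sumEval, mul_tsum]
    refine tsum_congr fun n => ?_
    conv_lhs => rw [hD, mul_pow, ← sumEval_pow, sumEval]
    simp only [mul_tsum, RingHom.comp_apply, map_mul]
    exact tsum_congr fun j => by ring
  simp only [hpow, coeff_coeff_tsum, coeff_coeff_monomial_mul]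

theorem coeff_coeff_pow_add (hU : U = X * sumEval (C.comp C) E D)
    (hD : D = C X * sumEval (C.comp C) F U) (k P q : ℕ) :
    coeff q (coeff (k + P) (U ^ k)) = ∑ n ∈ antidiagonal q, ∑ j ∈ antidiagonal P,
      coeff n.1 (E ^ k) * coeff j.1 (F ^ n.1) * coeff n.2 (coeff P (U ^ j.1)) := by
  rw [coeff_coeff_pow_eq_tsum hU hD,
    tsum_eq_sum_antidiagonal (q := q) fun n hn => by simp [hn.not_ge]]
  refine Finset.sum_congr rfl fun n hn => ?_
  have hn := mem_antidiagonal.1 hn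
  rw [tsum_eq_sum_antidiagonal (q := P) fun j hj => ?_]
  · refine Finset.sum_congr rfl fun j _ => ?_
    rw [if_pos (by omega), Nat.add_sub_cancel_left, ← hn, Nat.add_sub_cancel_left]
  · rw [Nat.add_sub_cancel_left, coeff_coeff_pow_of_lt hU hj, mul_zero, ite_self]

-- Lagrange inversion for the system `U = X E(D)`, `D = Y F(U)`.
theorem natCast_mul_coeff_coeff_pow (hA : ∀ n : ℕ, n ≠ 0 → IsUnit (n : A))
    (hU : U = X * sumEval (C.comp C) E D) (hD : D = C X * sumEval (C.comp C) F U)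
    {k p : ℕ} (hkp : k ≤ p) (q : ℕ) :
    (p : A) * coeff q (coeff p (U ^ k)) = k * (coeff q (E ^ p) * coeff (p - k) (F ^ q)) := by
  obtain ⟨P, rfl⟩ := Nat.exists_eq_add_of_le hkp
  rw [Nat.add_sub_cancel_left]
  refine add_mul_eq_of_lagrange_recursion hA E F (W := fun k p q => coeff q (coeff p (U ^ k)))
    (fun p q => ?_) (coeff_coeff_pow_add hU hD) k P q
  rw [pow_zero, coeff_one, ite_and]
  split_ifs with hp hq
  · rw [coeff_one, if_pos hq]
  · rw [coeff_one, if_neg hq]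
  · rw [map_zero]

theorem coeff_coeff_sumEval (hU : U = X * sumEval (C.comp C) E D) (G : PowerSeries A) (p q : ℕ) :
    coeff q (coeff p (sumEval (C.comp C) G U)) =
      ∑ x ∈ antidiagonal p, coeff x.1 G * coeff q (coeff p (U ^ x.1)) := by
  simp only [sumEval, coeff_coeff_tsum, RingHom.comp_apply, coeff_C_mul]
  exact tsum_eq_sum_antidiagonal fun n hn => by rw [coeff_coeff_pow_of_lt hU hn, mul_zero]

-- The point is that `L` depends on `F` and `G` only, so that `E` enters through `[x ^ q] E ^ p`.
theorem exists_coeff_coeff_sumEval_eq_mul {A' : Type*} [CommSemiring A'] (φ : A' →+* A)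
    (hA' : ∀ n : ℕ, n ≠ 0 → IsUnit (n : A')) {F' : PowerSeries A'}
    (hU : U = X * sumEval (C.comp C) E D) (hD : D = C X * sumEval (C.comp C) (F'.map φ) U)
    (G' : PowerSeries A') (p q : ℕ) :
    ∃ L : A', coeff q (coeff p (sumEval (C.comp C) (G'.map φ) U)) = coeff q (E ^ p) * φ L := by
  have hA : ∀ n : ℕ, n ≠ 0 → IsUnit (n : A) := fun n hn => by
    simpa using (hA' n hn).map φ
  rw [coeff_coeff_sumEval hU]
  rcases Nat.eq_zero_or_pos p with rfl | hp
  · refine ⟨coeff 0 G', ?_⟩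
    simp only [Finset.HasAntidiagonal.antidiagonal_zero, Finset.sum_singleton, pow_zero, coeff_map,
      coeff_zero_one]
    exact mul_comm _ _
  · obtain ⟨c, hc⟩ := hA' p hp.ne'
    refine ⟨↑c⁻¹ * ∑ x ∈ antidiagonal p, coeff x.1 G' * (x.1 * coeff x.2 (F' ^ q)), ?_⟩
    refine (hA p hp.ne').mul_left_cancel ?_
    have hcancel : (p : A) * φ ↑c⁻¹ = 1 := by
      rw [← map_natCast φ, ← map_mul, ← hc, Units.mul_inv, map_one]
    rw [map_mul, mul_left_comm, ← mul_assoc (p : A), hcancel, one_mul, map_sum, Finset.mul_sum,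
      Finset.mul_sum]
    refine Finset.sum_congr rfl fun x hx => ?_
    have hx := mem_antidiagonal.1 hx
    rw [mul_left_comm, natCast_mul_coeff_coeff_pow hA hU hD (by omega),
      show p - x.1 = x.2 by omega, map_mul, map_mul, map_natCast, ← map_pow, coeff_map, coeff_map]
    ring

end System

end Lagrange

namespace LTree

open IsCompleteSemiring

theorem induct {P : LTree → Prop} (h : ∀ a cs, (∀ c ∈ cs, P c) → P (node a cs)) (t : LTree) : P t :=
  edges.induct P h t

/-- A labelled tree is its root label together with the list of the subtrees branching off the
children of the root. -/
def equivProd : LTree ≃ ℤ × List LTree where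
  toFun t := t.casesOn fun a cs => (a, cs)
  invFun p := node p.1 p.2
  left_inv := by rintro ⟨a, cs⟩; rfl
  right_inv _ := rfl

theorem rootLabel_trunc (l : ℤ) (t : LTree) : (t.trunc l).rootLabel = t.rootLabel := by
  cases t
  rw [trunc]
  rfl

section VertexProd

variable {A B : Type*} [CommSemiring A] [CommSemiring B]

/-- The multiplicative functional on labelled trees with vertex weights `w`: the product of
`w a ls` over the vertices, where `a` is the label of the vertex and `ls` the list of the labels of
its children. -/
def vertexProd (w : ℤ → List ℤ → B) : LTree → B
  | node a cs => w a (cs.map rootLabel) * (cs.map fun c => c.vertexProd w).prod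

theorem vertexProd_node (w : ℤ → List ℤ → B) (a : ℤ) (cs : List LTree) :
    (node a cs).vertexProd w = w a (cs.map rootLabel) * (cs.map (vertexProd w)).prod := by
  rw [vertexProd]

/-- The vertex weights `v` read through `φ`, times the product of the marks `z (a, b)` of the edges
from the vertex to its children. -/
def markEdges (φ : A →+* B) (z : ℤ × ℤ → B) (v : ℤ → List ℤ → A) (a : ℤ) (ls : List ℤ) : B :=
  φ (v a ls) * (ls.map fun b => z (a, b)).prod

theorem vertexProd_markEdges (φ : A →+* B) (z : ℤ × ℤ → B) (v : ℤ → List ℤ → A) (t : LTree) :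
    t.vertexProd (markEdges φ z v) = φ (t.vertexProd v) * (t.edges.map z).prod := by
  induction t using induct with
  | h a cs ih =>
  rw [vertexProd_node, vertexProd_node, List.map_congr_left ih, List.prod_map_mul, markEdges, edges,
    List.map_flatMap, List.flatMap, List.prod_flatten, List.map_map, List.map_map, map_mul,
    map_list_prod, List.map_map]
  simp only [Function.comp_def, List.map_cons, List.prod_cons, List.prod_map_mul]
  ring

/-- The vertex weights obtained by forcing the vertices labelled `l` to be leaves. -/
def cutAt (l : ℤ) (w : ℤ → List ℤ → B) (a : ℤ) (ls : List ℤ) : B :=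
  if a = l then (if ls = [] then 1 else 0) else w a ls

theorem cutAt_markEdges (φ : A →+* B) (z : ℤ × ℤ → B) (l : ℤ) (v : ℤ → List ℤ → A) :
    cutAt l (markEdges φ z v) = markEdges φ z (cutAt l v) := by
  funext a ls
  simp only [cutAt, markEdges]
  split_ifs with ha hls
  · simp [hls]
  · simp
  · rfl

theorem list_prod_map_pow {ι : Type*} (x : B) (n : ι → ℕ) (is : List ι) :
    (is.map fun i => x ^ n i).prod = x ^ (is.map n).sum := by
  induction is with
  | nil => simp
  | cons i is ih => rw [List.map_cons, List.prod_cons, ih, ← pow_add, List.map_cons, List.sum_cons]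

variable [TopologicalSpace B]

/-- The partition function of the trees with root label `x`, with vertex weights `w`. -/
noncomputable def partitionSum (w : ℤ → List ℤ → B) (x : ℤ) : B :=
  ∑' t : LTree, if t.rootLabel = x then t.vertexProd w else 0

variable [IsCompleteSemiring B]

theorem tsum_eq_tsum_node (f : LTree → B) : ∑' t, f t = ∑' a, ∑' cs, f (node a cs) := by
  rw [← equivProd.symm.tsum_eq f, tsum_prod]
  rfl

theorem tsum_ite_rootLabel (f : LTree → B) (x : ℤ) :
    ∑' t : LTree, (if t.rootLabel = x then f t else 0) = ∑' cs, f (node x cs) := by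
  rw [tsum_eq_tsum_node, tsum_eq_single x fun a ha => by simp [rootLabel, ha]]
  simp [rootLabel]

theorem tsum_list_map_trunc_eq (l : ℤ) (w : ℤ → List ℤ → B) (a : ℤ) (τs : List LTree) :
    ∑' cs : List LTree,
        (open Classical in if cs.map (trunc l) = τs then (node a cs).vertexProd w else 0) =
      w a (τs.map rootLabel) * (τs.map fun τ => ∑' t : LTree,
        open Classical in if t.trunc l = τ then t.vertexProd w else 0).prod := by
  classical
  rw [← tsum_list_map_eq, mul_tsum]
  refine tsum_congr fun cs => ?_
  split_ifs with h
  · rw [vertexProd_node, ← h, List.map_map]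
    simp only [Function.comp_def, rootLabel_trunc]
  · rw [mul_zero]

-- A tree with truncation `τ` arises in a unique way by grafting a tree at each leaf labelled `l`.
open Classical in
theorem tsum_trunc_eq (w : ℤ → List ℤ → B) (l : ℤ) (τ : LTree) :
    ∑' t : LTree, (if t.trunc l = τ then t.vertexProd w else 0) =
      τ.vertexProd (cutAt l w) * partitionSum w l ^ τ.labels.count l := by
  induction τ using induct with
  | h a τs ih =>
  have hroot : ∑' t : LTree, (if t.trunc l = node a τs then t.vertexProd w else 0) =
      ∑' cs, if (if a = l then [] else cs.map (trunc l)) = τs then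
        (node a cs).vertexProd w else 0 := by
    rw [tsum_eq_tsum_node, tsum_eq_single a fun b hb => by simp [trunc, hb]]
    simp only [trunc, node.injEq, true_and]
  rw [hroot, vertexProd_node, cutAt]
  by_cases ha : a = l
  · subst ha
    by_cases hτs : τs = []
    · subst hτs
      simp [labels, partitionSum, tsum_ite_rootLabel]
    · simp [hτs, Ne.symm hτs]
  · simp only [if_neg ha]
    rw [tsum_list_map_trunc_eq, List.map_congr_left ih, List.prod_map_mul, mul_assoc, labels,
      List.count_cons_of_ne ha, List.count_flatMap]
    rw [list_prod_map_pow]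
    rfl

theorem partitionSum_eq_tsum_trunc (w : ℤ → List ℤ → B) (l x : ℤ) :
    partitionSum w x = ∑' τ : LTree, if τ.rootLabel = x then
      τ.vertexProd (cutAt l w) * partitionSum w l ^ τ.labels.count l else 0 := by
  classical
  rw [partitionSum, tsum_eq_tsum_fiber (trunc l)]
  have hroot (τ t : LTree) :
      (if t.trunc l = τ then if t.rootLabel = x then t.vertexProd w else 0 else 0) =
        if τ.rootLabel = x then if t.trunc l = τ then t.vertexProd w else 0 else 0 := by
    by_cases ht : t.trunc l = τ
    · simp only [← ht, if_pos, rootLabel_trunc]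
    · simp only [ht, if_false, ite_self]
  refine tsum_congr fun τ => ?_
  simp only [hroot, ← tsum_trunc_eq]
  split_ifs
  · rfl
  · exact tsum_zero

end VertexProd

end LTree

section SumEvalMonomial

open IsCompleteSemiring
open scoped MvPowerSeries.WithPiTopology

theorem monomial_toFinsupp_coe {σ A : Type*} [DecidableEq σ] [CommSemiring A] (es : List σ)
    (a : A) : MvPowerSeries.monomial (Multiset.toFinsupp (es : Multiset σ)) a =
      MvPowerSeries.C a * (es.map MvPowerSeries.X).prod := by
  induction es with
  | nil => simp
  | cons e es ih =>
    rw [List.map_cons, List.prod_cons, mul_left_comm, ← ih, ← Multiset.cons_coe,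
      ← Multiset.singleton_add, map_add, Multiset.toFinsupp_singleton, MvPowerSeries.X,
      MvPowerSeries.monomial_mul_monomial, one_mul]

theorem sumEval_tsum_monomial {ι : Type} {A B : Type*} [CommSemiring A] [TopologicalSpace A]
    [IsCompleteSemiring A] [CommSemiring B] [TopologicalSpace B] [IsCompleteSemiring B]
    {φ : A →+* B} (hφ : Continuous φ) (n : ι → ℕ) (a : ι → A) (y : B) :
    sumEval φ (∑' i, PowerSeries.monomial (n i) (a i)) y = ∑' i, φ (a i) * y ^ n i := by
  have hcoeff (k : ℕ) : φ (PowerSeries.coeff k (∑' i, PowerSeries.monomial (n i) (a i))) * y ^ k =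
      ∑' i, if n i = k then φ (a i) * y ^ n i else 0 := by
    rw [PowerSeries.coeff, coeff_tsum, (summable _).map_tsum φ hφ, tsum_mul]
    refine tsum_congr fun i => ?_
    rw [← PowerSeries.coeff, PowerSeries.coeff_monomial]
    by_cases h : n i = k
    · simp [h]
    · simp [h, Ne.symm h]
  rw [sumEval, tsum_congr hcoeff, ← tsum_eq_tsum_fiber n]

end SumEvalMonomial

namespace LTree

open IsCompleteSemiring
open scoped MvPowerSeries.WithPiTopology

section Exit

/-- Under the vertex weights `v`, an edge leading out of the set of labels `S` goes from the
label `u` to the label `l`. -/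
structure ExitsThrough {A : Type*} [Zero A] (v : ℤ → List ℤ → A) (S : Set ℤ) (u l : ℤ) : Prop where
  notMem : l ∉ S
  mem_or_eq {a : ℤ} {ls : List ℤ} (hv : v a ls ≠ 0) (ha : a ∈ S) {b : ℤ} (hb : b ∈ ls) :
    b ∈ S ∨ (a = u ∧ b = l)

variable {A : Type*} [CommSemiring A] {v : ℤ → List ℤ → A} {S : Set ℤ} {u l : ℤ}

theorem vertexProd_ne_zero_of_mem {a : ℤ} {cs : List LTree} (h : (node a cs).vertexProd v ≠ 0)
    {c : LTree} (hc : c ∈ cs) : c.vertexProd v ≠ 0 := fun h0 =>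
  right_ne_zero_of_mul (vertexProd_node v a cs ▸ h)
    (List.prod_eq_zero (h0 ▸ List.mem_map_of_mem hc))

theorem ExitsThrough.child_mem_or_eq (hS : ExitsThrough v S u l) {a : ℤ} (ha : a ∈ S)
    {cs : List LTree} (h : (node a cs).vertexProd (cutAt l v) ≠ 0) {c : LTree} (hc : c ∈ cs) :
    c.rootLabel ∈ S ∨ (a = u ∧ c.rootLabel = l) := by
  have hv := left_ne_zero_of_mul (vertexProd_node (cutAt l v) a cs ▸ h)
  rw [cutAt, if_neg (ne_of_mem_of_not_mem ha hS.notMem)] at hv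
  exact hS.mem_or_eq hv ha (List.mem_map_of_mem hc)

theorem eq_nil_of_vertexProd_cutAt_ne_zero {cs : List LTree}
    (h : (node l cs).vertexProd (cutAt l v) ≠ 0) : cs = [] := by
  by_contra hcs
  simp [vertexProd_node, cutAt, hcs] at h

theorem ExitsThrough.edges_subset (hS : ExitsThrough v S u l) {τ : LTree}
    (hτ : τ.vertexProd (cutAt l v) ≠ 0) (hr : τ.rootLabel ∈ S ∨ τ.rootLabel = l) :
    ∀ e ∈ τ.edges, (e.1 ∈ S ∧ e.2 ∈ S) ∨ e = (u, l) := by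
  induction τ using induct with
  | h a cs ih =>
  rcases hr with (ha : a ∈ S) | (rfl : a = l)
  · intro e he
    rw [edges, List.mem_flatMap] at he
    obtain ⟨c, hc, he⟩ := he
    have hcS := hS.child_mem_or_eq ha hτ hc
    rcases List.mem_cons.1 he with rfl | he
    · exact hcS.imp (⟨ha, ·⟩) fun h => by rw [← h.1, ← h.2]
    · exact ih c hc (vertexProd_ne_zero_of_mem hτ hc) (hcS.imp_right And.right) e he
  · simp [eq_nil_of_vertexProd_cutAt_ne_zero hτ, edges]

theorem ExitsThrough.count_labels (hS : ExitsThrough v S u l) {τ : LTree}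
    (hτ : τ.vertexProd (cutAt l v) ≠ 0) (hr : τ.rootLabel ∈ S ∨ τ.rootLabel = l) :
    τ.labels.count l = τ.edges.count (u, l) + if τ.rootLabel = l then 1 else 0 := by
  induction τ using induct with
  | h a cs ih =>
  rcases hr with (ha : a ∈ S) | (rfl : a = l)
  · have hal := ne_of_mem_of_not_mem ha hS.notMem
    rw [labels, edges, List.count_cons_of_ne hal, List.count_flatMap, List.count_flatMap,
      rootLabel, if_neg hal, add_zero]
    congr 1
    refine List.map_congr_left fun c hc => ?_
    have hcS := hS.child_mem_or_eq ha hτ hc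
    simp only [Function.comp_apply]
    rw [ih c hc (vertexProd_ne_zero_of_mem hτ hc) (hcS.imp_right And.right), List.count_cons]
    congr 1
    rcases hcS with h | ⟨rfl, h⟩
    · simp [ne_of_mem_of_not_mem h hS.notMem]
    · simp [h]
  · simp [eq_nil_of_vertexProd_cutAt_ne_zero hτ, edges, labels, rootLabel]

end Exit

section TruncSeries

variable {R : Type*} [CommSemiring R] [TopologicalSpace R]

/-- The edges whose pair of labels is not `e`. -/
def edgesExcept (e : ℤ × ℤ) (t : LTree) : Multiset (ℤ × ℤ) :=
  (t.edges.filter (· != e) : List (ℤ × ℤ))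

/-- The generating series of the trees with root label `x` whose vertices labelled `l` are leaves,
with vertex weights `v`. The variable counts the leaves labelled `l`, and the monomial in the
coefficient records the edges other than `(u, l)`. -/
noncomputable def truncSeries (v : ℤ → List ℤ → R) (u l x : ℤ) :
    PowerSeries (MvPowerSeries (ℤ × ℤ) R) :=
  ∑' τ : LTree, PowerSeries.monomial (τ.labels.count l)
    (MvPowerSeries.monomial (τ.edgesExcept (u, l)).toFinsupp
      (if τ.rootLabel = x then τ.vertexProd (cutAt l v) else 0))

theorem prod_map_eq_pow_count_mul_prod_filter {σ B : Type*} [BEq σ] [LawfulBEq σ] [CommMonoid B]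
    (z : σ → B) (e : σ) (es : List σ) :
    (es.map z).prod = z e ^ es.count e * ((es.filter (· != e)).map z).prod := by
  induction es with
  | nil => simp
  | cons e' es ih =>
    by_cases h : e' = e
    · simp [h, ih, pow_succ', mul_assoc]
    · simp [h, ih, mul_left_comm]

variable [IsCompleteSemiring R] {B : Type*} [CommSemiring B] [TopologicalSpace B]
  [IsCompleteSemiring B]

theorem partitionSum_eq_sumEval_truncSeries {v : ℤ → List ℤ → R} {S : Set ℤ} {u l x : ℤ}
    (hS : ExitsThrough v S u l) (hx : x ∈ S) {φ : MvPowerSeries (ℤ × ℤ) R →+* B}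
    (hφ : Continuous φ) {z : ℤ × ℤ → B} (hz : ∀ e, e.1 ∈ S → e.2 ∈ S → z e = φ (.X e)) :
    partitionSum (markEdges (φ.comp MvPowerSeries.C) z v) x =
      sumEval φ (truncSeries v u l x)
        (z (u, l) * partitionSum (markEdges (φ.comp MvPowerSeries.C) z v) l) := by
  rw [truncSeries, sumEval_tsum_monomial hφ, partitionSum_eq_tsum_trunc _ l]
  refine tsum_congr fun τ => ?_
  split_ifs with hτ
  swap
  · rw [map_zero, map_zero, zero_mul]
  rw [cutAt_markEdges, vertexProd_markEdges]
  by_cases h0 : τ.vertexProd (cutAt l v) = 0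
  · rw [h0, map_zero, map_zero, map_zero, zero_mul, zero_mul, zero_mul]
  have hcount : τ.edges.count (u, l) = τ.labels.count l := by
    rw [hS.count_labels h0 (Or.inl (hτ ▸ hx)), hτ, if_neg (ne_of_mem_of_not_mem hx hS.notMem),
      add_zero]
  have hmark : (τ.edges.filter (· != (u, l))).map z =
      (τ.edges.filter (· != (u, l))).map fun e => φ (.X e) := by
    refine List.map_congr_left fun e he => ?_
    rw [List.mem_filter, bne_iff_ne] at he
    have heS := (hS.edges_subset h0 (Or.inl (hτ ▸ hx)) e he.1).resolve_right he.2
    exact hz e heS.1 heS.2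
  rw [prod_map_eq_pow_count_mul_prod_filter z (u, l), hcount, hmark, edgesExcept,
    monomial_toFinsupp_coe, map_mul, map_list_prod, List.map_map, RingHom.comp_apply, mul_pow]
  simp only [Function.comp_def]
  ring

end TruncSeries

/-- The edges above the level between the labels `0` and `1`. -/
def edgesAbove (t : LTree) : Multiset (ℤ × ℤ) :=
  (t.edges : Multiset (ℤ × ℤ)).filter fun e => 1 ≤ e.1 ∧ 1 ≤ e.2

/-- The edges below the level between the labels `0` and `1`. -/
def edgesBelow (t : LTree) : Multiset (ℤ × ℤ) :=
  (t.edges : Multiset (ℤ × ℤ)).filter fun e => e.1 ≤ 0 ∧ e.2 ≤ 0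

section Marks

variable (R : Type*) [CommSemiring R]

/-- Power series in two variables, for the two kinds of edges crossing between the labels `0` and
`1`, over power series in the edges above, over power series in the edges below. -/
abbrev EdgeSeries : Type _ :=
  PowerSeries (PowerSeries (MvPowerSeries (ℤ × ℤ) (MvPowerSeries (ℤ × ℤ) R)))

/-- The inclusion of the power series in the edges above. -/
noncomputable def aboveHom : MvPowerSeries (ℤ × ℤ) R →+* EdgeSeries R :=
  (PowerSeries.C.comp PowerSeries.C).comp (MvPowerSeries.map MvPowerSeries.C)

/-- The inclusion of the power series in the edges below. -/
noncomputable def belowHom : MvPowerSeries (ℤ × ℤ) R →+* EdgeSeries R :=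
  (PowerSeries.C.comp PowerSeries.C).comp MvPowerSeries.C

theorem aboveHom_comp_C :
    (aboveHom R).comp MvPowerSeries.C = (belowHom R).comp MvPowerSeries.C := by
  ext1 a
  simp [aboveHom, belowHom]

theorem continuous_aboveHom [TopologicalSpace R] : Continuous (aboveHom R) := by
  have hmap : Continuous (MvPowerSeries.map (σ := ℤ × ℤ) (MvPowerSeries.C (σ := ℤ × ℤ) (R := R))) :=
    continuous_pi fun N => MvPowerSeries.WithPiTopology.continuous_C.comp
      (MvPowerSeries.WithPiTopology.continuous_coeff R N)
  exact PowerSeries.WithPiTopology.continuous_C.comp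
    (PowerSeries.WithPiTopology.continuous_C.comp hmap)

theorem continuous_belowHom [TopologicalSpace R] : Continuous (belowHom R) :=
  PowerSeries.WithPiTopology.continuous_C.comp
    (PowerSeries.WithPiTopology.continuous_C.comp MvPowerSeries.WithPiTopology.continuous_C)

/-- The formal variable recording an edge in `EdgeSeries`. -/
noncomputable def mark (e : ℤ × ℤ) : EdgeSeries R :=
  (if e = (0, 1) then PowerSeries.X else 1) *
    (if e = (1, 0) then PowerSeries.C PowerSeries.X else 1) *
    ((if 1 ≤ e.1 ∧ 1 ≤ e.2 then aboveHom R (.X e) else 1) *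
      (if e.1 ≤ 0 ∧ e.2 ≤ 0 then belowHom R (.X e) else 1))

theorem mark_of_above {e : ℤ × ℤ} (h₁ : 1 ≤ e.1) (h₂ : 1 ≤ e.2) :
    mark R e = aboveHom R (.X e) := by
  have h01 : e ≠ (0, 1) := by rintro rfl; simp at h₁
  have h10 : e ≠ (1, 0) := by rintro rfl; simp at h₂
  rw [mark, if_neg h01, if_neg h10, if_pos ⟨h₁, h₂⟩, if_neg (by omega), one_mul, one_mul, mul_one]

theorem mark_of_below {e : ℤ × ℤ} (h₁ : e.1 ≤ 0) (h₂ : e.2 ≤ 0) :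
    mark R e = belowHom R (.X e) := by
  have h01 : e ≠ (0, 1) := by rintro rfl; simp at h₂
  have h10 : e ≠ (1, 0) := by rintro rfl; simp at h₁
  rw [mark, if_neg h01, if_neg h10, if_neg (by omega), if_pos ⟨h₁, h₂⟩, one_mul, one_mul, one_mul]

theorem mark_zero_one : mark R (0, 1) = PowerSeries.X := by simp [mark]

theorem mark_one_zero : mark R (1, 0) = PowerSeries.C PowerSeries.X := by simp [mark]

theorem prod_map_ite_one {ι M : Type*} [CommMonoid M] (p : ι → Prop) [DecidablePred p] (f : ι → M)
    (is : List ι) :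
    (is.map fun i => if p i then f i else 1).prod = ((is.filter p).map f).prod := by
  simp [List.prod_map_ite]

theorem prod_map_ite_eq_one {ι M : Type*} [BEq ι] [LawfulBEq ι] [DecidableEq ι] [CommMonoid M]
    (i : ι) (x : M) (is : List ι) :
    (is.map fun j => if j = i then x else 1).prod = x ^ is.count i := by
  induction is with
  | nil => simp
  | cons j is ih => by_cases h : j = i <;> simp [h, ih, pow_succ']

theorem vertexProd_markEdges_mark (v : ℤ → List ℤ → R) (t : LTree) :
    t.vertexProd (markEdges ((belowHom R).comp MvPowerSeries.C) (mark R) v) =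
      .monomial (t.edges.count (0, 1)) (.monomial (t.edges.count (1, 0))
        (MvPowerSeries.monomial t.edgesAbove.toFinsupp
          (MvPowerSeries.monomial t.edgesBelow.toFinsupp (t.vertexProd v)))) := by
  have hfilter (φ : MvPowerSeries (ℤ × ℤ) R →+* EdgeSeries R) (p : ℤ × ℤ → Prop) [DecidablePred p] :
      ((t.edges.filter p).map fun e => φ (.X e)).prod = φ (MvPowerSeries.monomial
        (((t.edges : Multiset (ℤ × ℤ)).filter p).toFinsupp) 1) := by
    rw [Multiset.filter_coe, monomial_toFinsupp_coe, map_one, one_mul, map_list_prod, List.map_map]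
    rfl
  rw [vertexProd_markEdges]
  unfold mark
  simp only [List.prod_map_mul, prod_map_ite_eq_one]
  simp only [prod_map_ite_one, hfilter]
  simp only [aboveHom, belowHom, edgesAbove, edgesBelow, RingHom.comp_apply,
    MvPowerSeries.map_monomial]
  rw [← map_pow, PowerSeries.X_pow_eq, PowerSeries.X_pow_eq]
  simp only [← PowerSeries.monomial_zero_eq_C_apply, ← MvPowerSeries.monomial_zero_eq_C_apply,
    PowerSeries.monomial_mul_monomial, MvPowerSeries.monomial_mul_monomial, zero_add, add_zero,
    one_mul, mul_one]

end Marks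

section Factorization

variable {R : Type*} [CommSemiring R]

/-- Vertex weights under which labels change by `-1`, `0` or `1` along edges. -/
def NearestNeighbour (v : ℤ → List ℤ → R) : Prop :=
  ∀ a ls, v a ls ≠ 0 → ∀ b ∈ ls, b - a = -1 ∨ b - a = 0 ∨ b - a = 1

variable {v : ℤ → List ℤ → R}

theorem NearestNeighbour.exitsThrough_Iic (hv : NearestNeighbour v) :
    ExitsThrough v (Set.Iic 0) 0 1 where
  notMem := by simp
  mem_or_eq hne ha b hb := by
    have := hv _ _ hne b hb
    rw [Set.mem_Iic] at *
    omega

theorem NearestNeighbour.exitsThrough_Ici (hv : NearestNeighbour v) :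
    ExitsThrough v (Set.Ici 1) 1 0 where
  notMem := by simp
  mem_or_eq hne ha b hb := by
    have := hv _ _ hne b hb
    rw [Set.mem_Ici] at *
    omega

variable [TopologicalSpace R] [IsCompleteSemiring R]

/-- The generating series of the trees with root label `x`, in the formal variables recording the
edges. -/
noncomputable def edgeGenSeries (v : ℤ → List ℤ → R) (x : ℤ) : EdgeSeries R :=
  partitionSum (markEdges ((belowHom R).comp MvPowerSeries.C) (mark R) v) x

theorem edgeGenSeries_of_nonpos (hv : NearestNeighbour v) {x : ℤ} (hx : x ≤ 0) :
    edgeGenSeries v x =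
      sumEval (belowHom R) (truncSeries v 0 1 x) (PowerSeries.X * edgeGenSeries v 1) := by
  rw [← mark_zero_one]
  exact partitionSum_eq_sumEval_truncSeries hv.exitsThrough_Iic hx (continuous_belowHom R)
    fun _ => mark_of_below R

theorem edgeGenSeries_one (hv : NearestNeighbour v) :
    edgeGenSeries v 1 = sumEval (aboveHom R) (truncSeries v 1 0 1)
      (PowerSeries.C PowerSeries.X * edgeGenSeries v 0) := by
  rw [← mark_one_zero, edgeGenSeries, edgeGenSeries, ← aboveHom_comp_C]
  exact partitionSum_eq_sumEval_truncSeries hv.exitsThrough_Ici (Set.mem_Ici.2 le_rfl)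
    (continuous_aboveHom R) fun _ => mark_of_above R

theorem coeff_edgeGenSeries (v : ℤ → List ℤ → R) (x : ℤ) (p q : ℕ) (Na Nb : Multiset (ℤ × ℤ)) :
    MvPowerSeries.coeff Nb.toFinsupp (MvPowerSeries.coeff Na.toFinsupp
        (PowerSeries.coeff q (PowerSeries.coeff p (edgeGenSeries v x)))) =
      ∑' t : LTree, if t.rootLabel = x ∧ t.edges.count (0, 1) = p ∧ t.edges.count (1, 0) = q ∧
        t.edgesAbove = Na ∧ t.edgesBelow = Nb then t.vertexProd v else 0 := by
  classical
  rw [edgeGenSeries, partitionSum, coeff_coeff_tsum, coeff_tsum, coeff_tsum]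
  refine tsum_congr fun t => ?_
  simp only [vertexProd_markEdges_mark, ite_and, apply_ite (PowerSeries.coeff _),
    apply_ite (MvPowerSeries.coeff _), PowerSeries.coeff_monomial, MvPowerSeries.coeff_monomial,
    map_zero, EmbeddingLike.apply_eq_iff_eq, eq_comm (a := p), eq_comm (a := q), eq_comm (a := Na),
    eq_comm (a := Nb)]

theorem coeff_truncSeries_pow (v : ℤ → List ℤ → R) (u l x : ℤ) (p q : ℕ) (N : Multiset (ℤ × ℤ)) :
    MvPowerSeries.coeff N.toFinsupp (PowerSeries.coeff q (truncSeries v u l x ^ p)) =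
      ∑' τ : Fin p → LTree, if ∑ k, (τ k).labels.count l = q ∧
          ∑ k, (τ k).edgesExcept (u, l) = N then
        ∏ k, if (τ k).rootLabel = x then (τ k).vertexProd (cutAt l v) else 0 else 0 := by
  classical
  rw [truncSeries, coeff_tsum_monomial_pow, coeff_tsum]
  refine tsum_congr fun τ => ?_
  rw [ite_and]
  split_ifs with hq hN
  · rw [MvPowerSeries.prod_monomial, ← map_sum, hN, MvPowerSeries.coeff_monomial_same]
  · rw [MvPowerSeries.prod_monomial, ← map_sum, MvPowerSeries.coeff_monomial, if_neg]
    exact fun h => hN (Multiset.toFinsupp.injective h.symm)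
  · rw [map_zero]

theorem exists_coeff_edgeGenSeries_eq_mul (hR : ∀ n : ℕ, n ≠ 0 → IsUnit (n : R))
    (hv : NearestNeighbour v) {x : ℤ} (hx : x ≤ 0) (p q : ℕ) :
    ∃ L : MvPowerSeries (ℤ × ℤ) R, ∀ N N' : (ℤ × ℤ) →₀ ℕ,
      MvPowerSeries.coeff N' (MvPowerSeries.coeff N
        (PowerSeries.coeff q (PowerSeries.coeff p (edgeGenSeries v x)))) =
      MvPowerSeries.coeff N (PowerSeries.coeff q (truncSeries v 1 0 1 ^ p)) *
        MvPowerSeries.coeff N' L := by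
  have hA (n : ℕ) (hn : n ≠ 0) : IsUnit (n : MvPowerSeries (ℤ × ℤ) R) := by
    simpa using (hR n hn).map (MvPowerSeries.C (σ := ℤ × ℤ))
  have hU : PowerSeries.X * edgeGenSeries v 1 = PowerSeries.X *
      sumEval (PowerSeries.C.comp PowerSeries.C)
        ((truncSeries v 1 0 1).map (MvPowerSeries.map MvPowerSeries.C))
        (PowerSeries.C PowerSeries.X * edgeGenSeries v 0) := by
    rw [edgeGenSeries_one hv, aboveHom, ← sumEval_map]
  have hD : PowerSeries.C PowerSeries.X * edgeGenSeries v 0 = PowerSeries.C PowerSeries.X *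
      sumEval (PowerSeries.C.comp PowerSeries.C) ((truncSeries v 0 1 0).map MvPowerSeries.C)
        (PowerSeries.X * edgeGenSeries v 1) := by
    rw [edgeGenSeries_of_nonpos hv le_rfl, belowHom, ← sumEval_map]
  obtain ⟨L, hL⟩ := exists_coeff_coeff_sumEval_eq_mul _ hA hU hD (truncSeries v 0 1 x) p q
  refine ⟨L, fun N N' => ?_⟩
  rw [edgeGenSeries_of_nonpos hv hx, belowHom, ← sumEval_map, hL, ← map_pow, PowerSeries.coeff_map,
    MvPowerSeries.coeff_mul_C, MvPowerSeries.coeff_map, MvPowerSeries.coeff_C_mul]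

theorem exists_tsum_eq_mul (hR : ∀ n : ℕ, n ≠ 0 → IsUnit (n : R))
    (hv : NearestNeighbour v) {x : ℤ} (hx : x ≤ 0) (p q : ℕ) :
    ∃ L : Multiset (ℤ × ℤ) → R, ∀ Na Nb : Multiset (ℤ × ℤ),
      ∑' t : LTree, (if t.rootLabel = x ∧ t.edges.count (0, 1) = p ∧ t.edges.count (1, 0) = q ∧
        t.edgesAbove = Na ∧ t.edgesBelow = Nb then t.vertexProd v else 0) =
      (∑' τ : Fin p → LTree, if ∑ k, (τ k).zeros = q ∧ ∑ k, (τ k).edgesExcept (1, 0) = Na then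
        ∏ k, if (τ k).rootLabel = 1 then (τ k).vertexProd (cutAt 0 v) else 0 else 0) * L Nb := by
  obtain ⟨L, hL⟩ := exists_coeff_edgeGenSeries_eq_mul hR hv hx p q
  refine ⟨fun Nb => MvPowerSeries.coeff Nb.toFinsupp L, fun Na Nb => ?_⟩
  rw [← coeff_edgeGenSeries, hL, coeff_truncSeries_pow]
  rfl

end Factorization

theorem size_node (a : ℤ) (cs : List LTree) :
    (node a cs).size = (cs.map fun c => c.size + 1).sum := by
  simp [size, edges, List.length_flatMap]

theorem size_lt_size_node {a : ℤ} {cs : List LTree} {c : LTree} (hc : c ∈ cs) :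
    c.size < (node a cs).size := by
  rw [size_node]
  exact List.single_le_sum (fun _ _ => Nat.zero_le _) _ (List.mem_map_of_mem hc)

theorem countable_size_lt (n : ℕ) : {t : LTree | t.size < n}.Countable := by
  induction n with
  | zero => simp
  | succ n ih =>
    have := ih.to_subtype
    refine (Set.countable_range fun p : ℤ × List {t : LTree | t.size < n} =>
      node p.1 (p.2.map Subtype.val)).mono ?_
    rintro ⟨a, cs⟩ h
    have hcs (c : LTree) (hc : c ∈ cs) : c ∈ {t : LTree | t.size < n} :=
      (size_lt_size_node hc).trans_le (Nat.lt_succ_iff.1 h)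
    exact ⟨(a, cs.attach.map fun c => ⟨c.1, hcs c.1 c.2⟩), by
      simp [List.map_map, Function.comp_def]⟩

instance : Countable LTree :=
  Set.countable_univ_iff.1 <| (Set.countable_iUnion countable_size_lt).mono fun t _ =>
    Set.mem_iUnion.2 ⟨t.size + 1, Nat.lt_succ_self _⟩

instance : DiscreteMeasurableSpace LTree := ⟨fun _ => trivial⟩

section ChildFactor

variable (ξ : PMF ℕ) (η : (k : ℕ) → PMF (Fin k → ℤ))

/-- The vertex weights of the labelled Galton-Watson tree: the probability that a vertex labelled
`a` has children with labels `ls`. -/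
noncomputable def childFactor (a : ℤ) (ls : List ℤ) : ℝ≥0∞ :=
  ξ ls.length * η ls.length fun i => ls.get i - a

theorem childFactor_eq_of_length_eq {k : ℕ} (a : ℤ) {ls : List ℤ} (hk : ls.length = k)
    (e : Fin k → ℤ) (h : ∀ i, ls.get i - a = e (Fin.cast hk i)) :
    childFactor ξ η a ls = ξ k * η k e := by
  subst hk
  rw [childFactor, show (fun i => ls.get i - a) = e from funext h]

theorem weight_eq_vertexProd (t : LTree) : t.weight ξ η = t.vertexProd (childFactor ξ η) := by
  induction t using induct with
  | h a cs ih =>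
  rw [weight, vertexProd_node, List.map_congr_left ih, childFactor_eq_of_length_eq ξ η a
    (List.length_map rootLabel) (fun i => (cs.get i).rootLabel - a) fun i => by simp]

theorem childFactor_map_add (b a : ℤ) (ls : List ℤ) :
    childFactor ξ η (a + b) (ls.map (· + b)) = childFactor ξ η a ls :=
  childFactor_eq_of_length_eq ξ η _ (List.length_map _) _ fun i => by simp

theorem tsum_childFactor (a : ℤ) : ∑' ls, childFactor ξ η a ls = 1 := by
  have hk (k : ℕ) :
      ∑' e : Fin k → ℤ, childFactor ξ η a (List.equivSigmaTuple.symm ⟨k, e⟩) = ξ k := by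
    have hofFn (e : Fin k → ℤ) : childFactor ξ η a (List.equivSigmaTuple.symm ⟨k, e⟩) =
        ξ k * η k (Equiv.subRight (fun _ => a) e) :=
      childFactor_eq_of_length_eq ξ η a (List.length_ofFn (f := e)) _ fun i =>
        congrArg (· - a) (List.get_ofFn e i)
    simp only [hofFn]
    rw [ENNReal.tsum_mul_left, (Equiv.subRight fun _ : Fin k => a).tsum_eq (η k), (η k).tsum_coe,
      mul_one]
  rw [← List.equivSigmaTuple.symm.tsum_eq, ENNReal.tsum_sigma', tsum_congr hk, ξ.tsum_coe]

theorem nearestNeighbour_childFactor {ξ : PMF ℕ} {η : (k : ℕ) → PMF (Fin k → ℤ)}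
    (hη : ∀ (k : ℕ) (e : Fin k → ℤ), η k e ≠ 0 → ∀ i, e i = -1 ∨ e i = 0 ∨ e i = 1) :
    NearestNeighbour (childFactor ξ η) := fun a ls hne b hb => by
  obtain ⟨i, rfl⟩ := List.get_of_mem hb
  exact hη _ _ (right_ne_zero_of_mul hne) i

end ChildFactor

section Subprobability

variable {w : ℤ → List ℤ → ℝ≥0∞}

theorem tsum_vertexProd_size_lt_le_one (hw : ∀ a, ∑' ls, w a ls ≤ 1) (n : ℕ) (x : ℤ) :
    ∑' t : LTree, (if t.rootLabel = x then if t.size < n then t.vertexProd w else 0 else 0) ≤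
      1 := by
  classical
  induction n generalizing x with
  | zero => simp
  | succ n ih =>
    let f (c : LTree) : ℝ≥0∞ := if c.size < n then c.vertexProd w else 0
    have hnode (cs : List LTree) :
        (if (node x cs).size < n + 1 then (node x cs).vertexProd w else 0) ≤
          w x (cs.map rootLabel) * (cs.map f).prod := by
      split_ifs with h
      · rw [vertexProd_node]
        refine le_of_eq (congrArg _ (congrArg _ (List.map_congr_left fun c hc => ?_)))
        exact (if_pos ((size_lt_size_node hc).trans_le (Nat.lt_succ_iff.1 h))).symm
      · exact zero_le
    have hsubtrees (ls : List ℤ) :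
        ∑' cs : List LTree, (if cs.map rootLabel = ls then (cs.map f).prod else 0) ≤ 1 := by
      rw [IsCompleteSemiring.tsum_list_map_eq]
      refine (List.prod_le_pow_card _ 1 fun _ hb => ?_).trans_eq (one_pow _)
      obtain ⟨b, -, rfl⟩ := List.mem_map.1 hb
      exact ih b
    calc _ = ∑' cs, if (node x cs).size < n + 1 then (node x cs).vertexProd w else 0 :=
          tsum_ite_rootLabel _ x
      _ ≤ ∑' cs, w x (cs.map rootLabel) * (cs.map f).prod := ENNReal.tsum_le_tsum hnode
      _ = ∑' ls, w x ls * ∑' cs : List LTree, if cs.map rootLabel = ls then (cs.map f).prod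
            else 0 := by
          simp only [← ENNReal.tsum_mul_left, mul_ite, mul_zero]
          rw [ENNReal.tsum_comm]
          simp
      _ ≤ ∑' ls, w x ls := ENNReal.tsum_le_tsum fun ls => mul_le_of_le_one_right' (hsubtrees ls)
      _ ≤ 1 := hw x

theorem partitionSum_le_one (hw : ∀ a, ∑' ls, w a ls ≤ 1) (x : ℤ) : partitionSum w x ≤ 1 := by
  rw [partitionSum, ENNReal.tsum_eq_iSup_sum]
  refine iSup_le fun s =>
    le_trans ?_ (tsum_vertexProd_size_lt_le_one hw (s.sup size + 1) x)
  refine le_trans (Finset.sum_le_sum fun t ht => ?_) (ENNReal.sum_le_tsum s)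
  rw [if_pos (Nat.lt_succ_iff.2 (Finset.le_sup ht))]

end Subprobability

section Laws

variable (ξ : PMF ℕ) (η : (k : ℕ) → PMF (Fin k → ℤ))

open Classical in
theorem treeLaw_apply (x : ℤ) (A : Set LTree) :
    treeLaw ξ η x A =
      ∑' t : LTree, if t.rootLabel = x ∧ t ∈ A then t.vertexProd (childFactor ξ η) else 0 := by
  rw [treeLaw, Measure.restrict_apply .of_discrete, Measure.sum_apply _ .of_discrete]
  refine tsum_congr fun t => ?_
  rw [Measure.smul_apply, Measure.dirac_apply' _ .of_discrete, weight_eq_vertexProd, smul_eq_mul,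
    Set.indicator_apply, Pi.one_apply, mul_ite, mul_one, mul_zero]
  exact if_congr and_comm rfl rfl

theorem treeLaw_univ (x : ℤ) : treeLaw ξ η x Set.univ = partitionSum (childFactor ξ η) x := by
  simp [treeLaw_apply, partitionSum]

instance (x : ℤ) : IsFiniteMeasure (treeLaw ξ η x) :=
  ⟨(treeLaw_univ ξ η x).trans_le (partitionSum_le_one (fun a => (tsum_childFactor ξ η a).le) x)
    |>.trans_lt ENNReal.one_lt_top⟩

instance : IsFiniteMeasure (posExcursionLaw ξ η) :=
  Measure.isFiniteMeasure_map _ _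

theorem posExcursionLaw_singleton (τ : LTree) :
    posExcursionLaw ξ η {τ} =
      (if τ.rootLabel = 1 then τ.vertexProd (cutAt 0 (childFactor ξ η)) else 0) *
        treeLaw ξ η 0 Set.univ ^ τ.zeros := by
  classical
  have hroot (t : LTree) : (t.rootLabel = 1 ∧ t.trunc 0 = τ) ↔
      (τ.rootLabel = 1 ∧ t.trunc 0 = τ) :=
    and_congr_left fun h => by rw [← h, rootLabel_trunc]
  rw [posExcursionLaw, Measure.map_apply .of_discrete .of_discrete, treeLaw_apply, treeLaw_univ]
  simp only [Set.mem_preimage, Set.mem_singleton_iff, hroot, ite_and]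
  split_ifs
  · exact tsum_trunc_eq _ _ _
  · rw [tsum_zero, zero_mul]

end Laws

end LTree

section MeasureFiber

variable {Ω S : Type*} [MeasurableSpace Ω] [DiscreteMeasurableSpace Ω] [Countable S]

theorem measure_and_mem_eq_tsum (μ : Measure Ω) (A : Set Ω) (f : Ω → S) (Q : Set S) :
    μ {ω | ω ∈ A ∧ f ω ∈ Q} = ∑' b : Q, μ {ω | ω ∈ A ∧ f ω = b} := by
  have hrestrict (B : Set S) : μ {ω | ω ∈ A ∧ f ω ∈ B} = μ.restrict A (f ⁻¹' B) := by
    rw [Measure.restrict_apply .of_discrete, Set.inter_comm]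
    rfl
  rw [hrestrict, ← tsum_measure_preimage_singleton Q.to_countable fun _ _ => .of_discrete]
  exact tsum_congr fun b => (hrestrict {b.1}).symm

theorem measure_and_mem_and_mem_eq_mul {T : Type*} [Countable T] (μ : Measure Ω) {A : Set Ω}
    {f : Ω → S} {g : Ω → T} {φ : S → ℝ≥0∞} {ψ : T → ℝ≥0∞}
    (h : ∀ a b, μ {ω | ω ∈ A ∧ f ω = a ∧ g ω = b} = φ a * ψ b) (Q : Set S) (R : Set T) :
    μ {ω | ω ∈ A ∧ f ω ∈ Q ∧ g ω ∈ R} = (∑' a : Q, φ a) * ∑' b : R, ψ b := by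
  have hprod : μ {ω | ω ∈ A ∧ f ω ∈ Q ∧ g ω ∈ R} =
      μ {ω | ω ∈ A ∧ (f ω, g ω) ∈ Q ×ˢ R} := rfl
  rw [hprod, measure_and_mem_eq_tsum, ← (Equiv.Set.prod Q R).symm.tsum_eq, ENNReal.tsum_prod',
    ← ENNReal.tsum_mul_right]
  refine tsum_congr fun a => ?_
  rw [← ENNReal.tsum_mul_left]
  refine tsum_congr fun b => ?_
  rw [← h]
  exact congrArg μ (Set.ext fun ω => and_congr_right fun _ => Prod.ext_iff)

end MeasureFiber

namespace LTree

section SpatialMarkov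

variable (ξ : PMF ℕ) (η : (k : ℕ) → PMF (Fin k → ℤ))

/-- The law of `p` independent positive excursions given that they have `q` zeros in total. -/
noncomputable def excursionLaw (p q : ℕ) : Measure (Fin p → LTree) :=
  (Measure.pi fun _ : Fin p => posExcursionLaw ξ η)[|{τ | ∑ k, (τ k).zeros = q}]

theorem pi_posExcursionLaw_apply (p q : ℕ) (A : Set (Fin p → LTree)) [DecidablePred (· ∈ A)] :
    (Measure.pi fun _ : Fin p => posExcursionLaw ξ η) {τ | ∑ k, (τ k).zeros = q ∧ τ ∈ A} =
      (∑' τ : Fin p → LTree, if ∑ k, (τ k).zeros = q ∧ τ ∈ A then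
        ∏ k, if (τ k).rootLabel = 1 then (τ k).vertexProd (cutAt 0 (childFactor ξ η)) else 0
        else 0) * treeLaw ξ η 0 Set.univ ^ q := by
  classical
  rw [← Measure.tsum_indicator_apply_singleton _ _ .of_discrete, ← ENNReal.tsum_mul_right]
  refine tsum_congr fun τ => ?_
  simp only [Set.indicator_apply, Set.mem_ofPred_eq]
  split_ifs with h
  · simp only [Measure.pi_singleton, posExcursionLaw_singleton]
    rw [Finset.prod_mul_distrib, Finset.prod_pow_eq_pow_sum, h.1]
  · rw [zero_mul]

variable {ξ η} {x : ℤ}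

theorem exists_treeLaw_eq_mul (hη : NearestNeighbour (childFactor ξ η))
    (hZ : treeLaw ξ η 0 Set.univ ≠ 0) (hx : x ≤ 0) (p q : ℕ) (R : Set (Multiset (ℤ × ℤ))) :
    ∃ c : ℝ≥0∞, ∀ Q : Set (Multiset (ℤ × ℤ)),
      treeLaw ξ η x {t | (t.edges.count (0, 1) = p ∧ t.edges.count (1, 0) = q) ∧
        t.edgesAbove ∈ Q ∧ t.edgesBelow ∈ R} =
      (Measure.pi fun _ : Fin p => posExcursionLaw ξ η)
        {τ | ∑ k, (τ k).zeros = q ∧ ∑ k, (τ k).edgesExcept (1, 0) ∈ Q} * c := by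
  classical
  obtain ⟨L, hL⟩ := exists_tsum_eq_mul
    (fun n hn => ENNReal.isUnit_iff.2 ⟨Nat.cast_ne_zero.2 hn, ENNReal.natCast_ne_top n⟩) hη hx p q
  have hZq : treeLaw ξ η 0 Set.univ ^ q ≠ 0 := pow_ne_zero _ hZ
  have hatom (Na Nb : Multiset (ℤ × ℤ)) :
      treeLaw ξ η x {t | t ∈ {t : LTree | t.edges.count (0, 1) = p ∧ t.edges.count (1, 0) = q} ∧
        t.edgesAbove = Na ∧ t.edgesBelow = Nb} =
      (Measure.pi fun _ : Fin p => posExcursionLaw ξ η)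
        {τ | τ ∈ {τ : Fin p → LTree | ∑ k, (τ k).zeros = q} ∧
          ∑ k, (τ k).edgesExcept (1, 0) = Na} * ((treeLaw ξ η 0 Set.univ ^ q)⁻¹ * L Nb) := by
    have hpi := pi_posExcursionLaw_apply ξ η p q {τ | ∑ k, (τ k).edgesExcept (1, 0) = Na}
    simp only [Set.mem_ofPred_eq] at hpi ⊢
    rw [hpi, treeLaw_apply, ← mul_assoc, mul_assoc _ (_ ^ q),
      ENNReal.mul_inv_cancel hZq (ENNReal.pow_ne_top (measure_ne_top _ _)), mul_one, ← hL]
    simp only [Set.mem_ofPred_eq, and_assoc]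
  refine ⟨∑' Nb : R, (treeLaw ξ η 0 Set.univ ^ q)⁻¹ * L Nb, fun Q => ?_⟩
  exact (measure_and_mem_and_mem_eq_mul _ hatom Q R).trans
    (congrArg (· * _) (measure_and_mem_eq_tsum _ _ _ Q).symm)

theorem treeLaw_eq_mul_excursionLaw (hη : NearestNeighbour (childFactor ξ η))
    (hZ : treeLaw ξ η 0 Set.univ ≠ 0) (hx : x ≤ 0) (p q : ℕ) (R Q : Set (Multiset (ℤ × ℤ))) :
    treeLaw ξ η x {t | (t.edges.count (0, 1) = p ∧ t.edges.count (1, 0) = q) ∧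
        t.edgesAbove ∈ Q ∧ t.edgesBelow ∈ R} =
      treeLaw ξ η x {t | (t.edges.count (0, 1) = p ∧ t.edges.count (1, 0) = q) ∧
        t.edgesBelow ∈ R} * excursionLaw ξ η p q {τ | ∑ k, (τ k).edgesExcept (1, 0) ∈ Q} := by
  obtain ⟨c, hc⟩ := exists_treeLaw_eq_mul hη hZ hx p q R
  have huniv := hc Set.univ
  simp only [Set.mem_univ, true_and, and_true] at huniv
  rw [hc Q, huniv, excursionLaw, cond_apply .of_discrete]
  by_cases h0 : (Measure.pi fun _ : Fin p => posExcursionLaw ξ η) {τ | ∑ k, (τ k).zeros = q} = 0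
  · rw [h0, measure_mono_null (fun τ hτ => hτ.1) h0, zero_mul, zero_mul]
  · rw [mul_right_comm, ← mul_assoc, ENNReal.mul_inv_cancel h0 (measure_ne_top _ _), one_mul]
    rfl

end SpatialMarkov

section Shift

/-- Add `b` to all labels. -/
def shift (b : ℤ) : LTree → LTree
  | node a cs => node (a + b) (cs.map fun c => c.shift b)

theorem shift_node (b a : ℤ) (cs : List LTree) :
    (node a cs).shift b = node (a + b) (cs.map (shift b)) := by
  rw [shift]

theorem shift_shift_neg (b : ℤ) (t : LTree) : (t.shift b).shift (-b) = t := by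
  induction t using induct with
  | h a cs ih =>
  rw [shift_node, shift_node, List.map_map, add_neg_cancel_right]
  exact congrArg (node a) (List.map_congr_left ih |>.trans (List.map_id cs))

/-- Adding `b` to all labels, as a permutation of the labelled trees. -/
def shiftEquiv (b : ℤ) : LTree ≃ LTree where
  toFun := shift b
  invFun := shift (-b)
  left_inv := shift_shift_neg b
  right_inv t := by simpa only [neg_neg] using shift_shift_neg (-b) t

theorem rootLabel_shift (b : ℤ) (t : LTree) : (t.shift b).rootLabel = t.rootLabel + b := by
  cases t
  rw [shift_node]
  rfl

theorem edges_shift (b : ℤ) (t : LTree) :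
    (t.shift b).edges = t.edges.map fun e => (e.1 + b, e.2 + b) := by
  induction t using induct with
  | h a cs ih =>
  rw [shift_node, edges, edges, List.map_flatMap, List.flatMap_map]
  refine List.flatMap_congr fun c hc => ?_
  rw [ih c hc, rootLabel_shift, List.map_cons]

theorem size_shift (b : ℤ) (t : LTree) : (t.shift b).size = t.size := by
  rw [size, size, edges_shift, List.length_map]

theorem vertexProd_shift {R : Type*} [CommSemiring R] {w : ℤ → List ℤ → R} {b : ℤ}
    (hw : ∀ a ls, w (a + b) (ls.map (· + b)) = w a ls) (t : LTree) :
    (t.shift b).vertexProd w = t.vertexProd w := by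
  induction t using induct with
  | h a cs ih =>
  have hroot : (cs.map (shift b)).map rootLabel = (cs.map rootLabel).map (· + b) := by
    simp only [List.map_map, Function.comp_def, rootLabel_shift]
  rw [shift_node, vertexProd_node, vertexProd_node, hroot, hw, List.map_map]
  exact congrArg _ (congrArg _ (List.map_congr_left ih))

theorem treeLaw_preimage_shift (ξ : PMF ℕ) (η : (k : ℕ) → PMF (Fin k → ℤ)) (b x : ℤ)
    (A : Set LTree) : treeLaw ξ η x (shift b ⁻¹' A) = treeLaw ξ η (x + b) A := by
  classical
  rw [treeLaw_apply, treeLaw_apply]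
  refine Eq.trans (tsum_congr fun t => ?_) ((shiftEquiv b).tsum_eq _)
  change _ = if (t.shift b).rootLabel = x + b ∧ t.shift b ∈ A then (t.shift b).vertexProd _ else 0
  simp only [rootLabel_shift, add_left_inj, vertexProd_shift (childFactor_map_add ξ η b)]
  rfl

end Shift

section Profile

theorem coe_count_prod {α β : Type*} [DecidableEq α] [DecidableEq β] (l : List (α × β))
    (e : α × β) : (l : Multiset (α × β)).count e = l.count e := by
  rw [Multiset.coe_count]
  congr 1
  exact lawful_beq_subsingleton _ _

/-- The profile `(X_j^+, X_j^-, M_j^-)` at an arbitrary integer level `j`, as a function of the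
multiset of the edges. -/
def levelProfile (j : ℤ) (N : Multiset (ℤ × ℤ)) : ℕ × ℕ × ℕ :=
  (N.count (j - 1, j), N.count (j, j - 1), N.countP fun e => e.1 ≤ j - 1 ∧ e.2 ≤ j - 1)

theorem profile_shift (b : ℤ) (m : ℕ) (t : LTree) :
    (t.shift b).profile m = levelProfile (m - b) t.edges := by
  have hcountP (A B : ℤ × ℤ → Prop) [DecidablePred A] [DecidablePred B]
      (hAB : ∀ e, A (e.1 + b, e.2 + b) ↔ B e) :
      (t.shift b).edges.countP A = (t.edges : Multiset (ℤ × ℤ)).countP B := by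
    rw [edges_shift, List.countP_map, Multiset.coe_countP]
    exact List.countP_congr fun e _ => by simpa using hAB e
  have hcount (a c : ℤ) : (t.shift b).edges.count (a, c) =
      (t.edges : Multiset (ℤ × ℤ)).count (a - b, c - b) := by
    rw [← coe_count_prod, Multiset.count, Multiset.coe_countP]
    exact hcountP _ _ fun e => by simp only [Prod.ext_iff]; omega
  rw [profile, up, down, massBelow, levelProfile, hcount, hcount, sub_right_comm,
    hcountP _ (fun e => e.1 ≤ (m : ℤ) - b - 1 ∧ e.2 ≤ (m : ℤ) - b - 1) fun e => by
      simp only []; omega]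

theorem levelProfile_edges_of_nonpos {j : ℤ} (hj : j ≤ 0) (t : LTree) :
    levelProfile j t.edges = levelProfile j t.edgesBelow := by
  rw [levelProfile, levelProfile, edgesBelow,
    Multiset.count_filter_of_pos (by constructor <;> simp only [] <;> omega),
    Multiset.count_filter_of_pos (by constructor <;> simp only [] <;> omega),
    Multiset.countP_filter]
  congr 3
  funext e
  simp only [eq_iff_iff]
  omega

theorem levelProfile_one_edges (t : LTree) : levelProfile 1 t.edges =
    (t.edges.count (0, 1), t.edges.count (1, 0), Multiset.card t.edgesBelow) := by
  rw [levelProfile, edgesBelow, ← Multiset.countP_eq_card_filter]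
  simp only [sub_self, coe_count_prod]

theorem levelProfile_one_edges_eq_iff {t : LTree} {p q n : ℕ} :
    levelProfile 1 t.edges = (p, q, n) ↔
      (t.edges.count (0, 1) = p ∧ t.edges.count (1, 0) = q) ∧ Multiset.card t.edgesBelow = n := by
  rw [levelProfile_one_edges, Prod.mk.injEq, Prod.mk.injEq, and_assoc]

variable {R : Type*} [CommSemiring R] {v : ℤ → List ℤ → R}

theorem NearestNeighbour.edge_increment (hv : NearestNeighbour v) {t : LTree}
    (ht : t.vertexProd v ≠ 0) :
    ∀ e ∈ t.edges, e.2 - e.1 = -1 ∨ e.2 - e.1 = 0 ∨ e.2 - e.1 = 1 := by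
  induction t using induct with
  | h a cs ih =>
  intro e he
  rw [edges, List.mem_flatMap] at he
  obtain ⟨c, hc, he⟩ := he
  have hroot := ht
  rw [vertexProd_node] at hroot
  rcases List.mem_cons.1 he with rfl | he
  · exact hv a _ (left_ne_zero_of_mul hroot) _ (List.mem_map_of_mem hc)
  · exact ih c hc (vertexProd_ne_zero_of_mem ht hc) e he

theorem NearestNeighbour.edges_eq_add (hv : NearestNeighbour v) {t : LTree}
    (ht : t.vertexProd v ≠ 0) :
    (t.edges : Multiset (ℤ × ℤ)) = Multiset.replicate (t.edges.count (0, 1)) (0, 1) +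
      Multiset.replicate (t.edges.count (1, 0)) (1, 0) + t.edgesBelow + t.edgesAbove := by
  ext ⟨a, b⟩
  simp only [edgesAbove, edgesBelow, Multiset.count_add, Multiset.count_replicate,
    Multiset.count_filter, coe_count_prod, Prod.mk.injEq]
  by_cases he : (a, b) ∈ t.edges
  · have hab := hv.edge_increment ht _ he
    rcases (by omega : a = 0 ∧ b = 1 ∨ a = 1 ∧ b = 0 ∨ a ≤ 0 ∧ b ≤ 0 ∨ 1 ≤ a ∧ 1 ≤ b) with
      ⟨rfl, rfl⟩ | ⟨rfl, rfl⟩ | h | h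
    · simp
    · simp
    · grind
    · grind
  · have hzero := List.count_eq_zero_of_not_mem he
    grind

/-- The profile at level `2` of a tree with profile `x` at level `1`, as a function of the edges
above. -/
def nextProfile (x : ℕ × ℕ × ℕ) (N : Multiset (ℤ × ℤ)) : ℕ × ℕ × ℕ :=
  (N.count (1, 2), N.count (2, 1),
    x.1 + x.2.1 + x.2.2 + N.countP fun e => e.1 ≤ 1 ∧ e.2 ≤ 1)

theorem NearestNeighbour.levelProfile_two_edges (hv : NearestNeighbour v) {t : LTree}
    (ht : t.vertexProd v ≠ 0) :
    levelProfile 2 t.edges = nextProfile (levelProfile 1 t.edges) t.edgesAbove := by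
  have hmass : (t.edges : Multiset (ℤ × ℤ)).countP (fun e => e.1 ≤ 1 ∧ e.2 ≤ 1) =
      t.edges.count (0, 1) + t.edges.count (1, 0) + Multiset.card t.edgesBelow +
        t.edgesAbove.countP fun e => e.1 ≤ 1 ∧ e.2 ≤ 1 := by
    have hup (n : ℕ) : (Multiset.replicate n ((0 : ℤ), (1 : ℤ))).countP
        (fun e => e.1 ≤ 1 ∧ e.2 ≤ 1) = n :=
      (Multiset.countP_eq_card.2 fun e he => by
        rw [Multiset.eq_of_mem_replicate he]; norm_num).trans (Multiset.card_replicate _ _)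
    have hdown (n : ℕ) : (Multiset.replicate n ((1 : ℤ), (0 : ℤ))).countP
        (fun e => e.1 ≤ 1 ∧ e.2 ≤ 1) = n :=
      (Multiset.countP_eq_card.2 fun e he => by
        rw [Multiset.eq_of_mem_replicate he]; norm_num).trans (Multiset.card_replicate _ _)
    have hbelow : t.edgesBelow.countP (fun e => e.1 ≤ 1 ∧ e.2 ≤ 1) =
        Multiset.card t.edgesBelow :=
      Multiset.countP_eq_card.2 fun e he => by
        have := (Multiset.mem_filter.1 he).2
        omega
    rw [hv.edges_eq_add ht]
    simp only [Multiset.countP_add, hup, hdown, hbelow]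
  rw [levelProfile_one_edges, levelProfile, nextProfile, edgesAbove,
    Multiset.count_filter_of_pos (by norm_num), Multiset.count_filter_of_pos (by norm_num)]
  exact congrArg _ (congrArg _ hmass)

theorem NearestNeighbour.size_eq (hv : NearestNeighbour v) {t : LTree} (ht : t.vertexProd v ≠ 0)
    {p q n : ℕ} (hx : levelProfile 1 t.edges = (p, q, n)) :
    t.size = p + q + n + Multiset.card t.edgesAbove := by
  obtain ⟨⟨rfl, rfl⟩, rfl⟩ := levelProfile_one_edges_eq_iff.1 hx
  rw [size, ← Multiset.coe_card, hv.edges_eq_add ht]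
  simp only [Multiset.card_add, Multiset.card_replicate]

end Profile

section ExcursionLaw

variable {ξ : PMF ℕ} {η : (k : ℕ) → PMF (Fin k → ℤ)}

theorem excursionLaw_singleton_ne_zero {p q : ℕ} {τ : Fin p → LTree}
    (h : excursionLaw ξ η p q {τ} ≠ 0) :
    ∑ k, (τ k).zeros = q ∧ ∀ k, posExcursionLaw ξ η {τ k} ≠ 0 := by
  rw [excursionLaw, cond_apply .of_discrete] at h
  obtain ⟨τ', hq, rfl⟩ := nonempty_of_measure_ne_zero (right_ne_zero_of_mul h)
  have hpi := mt (measure_mono_null Set.inter_subset_right) (right_ne_zero_of_mul h)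
  rw [Measure.pi_singleton] at hpi
  exact ⟨hq, fun k hk => hpi (Finset.prod_eq_zero (Finset.mem_univ k) hk)⟩

theorem size_eq_card_edgesExcept_add_count (e : ℤ × ℤ) (t : LTree) :
    t.size = Multiset.card (t.edgesExcept e) + t.edges.count e := by
  rw [size, edgesExcept, Multiset.coe_card, List.count, ← List.countP_eq_length_filter, add_comm,
    List.length_eq_countP_add_countP (· == e)]
  simp only [bne, decide_not, Bool.decide_eq_true]

theorem NearestNeighbour.size_eq_card_edgesExcept_add_zeros
    (hη : NearestNeighbour (childFactor ξ η)) {τ : LTree} (hτ : posExcursionLaw ξ η {τ} ≠ 0) :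
    τ.size = Multiset.card (τ.edgesExcept (1, 0)) + τ.zeros := by
  rw [posExcursionLaw_singleton] at hτ
  have h := left_ne_zero_of_mul hτ
  rw [ne_eq, ite_eq_right_iff, not_forall] at h
  obtain ⟨hroot, hprod⟩ := h
  rw [zeros, hη.exitsThrough_Ici.count_labels hprod (Or.inl (by simp [hroot])), hroot,
    if_neg one_ne_zero, add_zero, size_eq_card_edgesExcept_add_count (1, 0)]

theorem harmonicH_eq_excursionLaw (hη : NearestNeighbour (childFactor ξ η)) (V p q n : ℕ) :
    harmonicH ξ η V (p, q, n) = excursionLaw ξ η p q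
      {τ | p + q + n + Multiset.card (∑ k, (τ k).edgesExcept (1, 0)) = V} := by
  refine measure_congr (ae_iff_of_countable.2 fun τ hτ => ?_)
  obtain ⟨hq, hpos⟩ := excursionLaw_singleton_ne_zero (ξ := ξ) (η := η) hτ
  have hsize : ∑ k, (τ k).size = Multiset.card (∑ k, (τ k).edgesExcept (1, 0)) + q := by
    rw [← hq, Multiset.card_sum, ← Finset.sum_add_distrib]
    exact Finset.sum_congr rfl fun k _ => hη.size_eq_card_edgesExcept_add_zeros (hpos k)
  refine propext ?_
  change ((∑ k, (τ k).size : ℕ) : ℤ) = (V : ℤ) - n - p ↔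
    p + q + n + Multiset.card (∑ k, (τ k).edgesExcept (1, 0)) = V
  omega

/-- The law of the profile at level `2` given that the profile at level `1` is `x`: the edges above
are those of `x.1` independent positive excursions with `x.2.1` zeros in total. -/
noncomputable def nextProfileLaw (ξ : PMF ℕ) (η : (k : ℕ) → PMF (Fin k → ℤ)) (x : ℕ × ℕ × ℕ) :
    Measure (ℕ × ℕ × ℕ) :=
  (excursionLaw ξ η x.1 x.2.1).map fun τ => nextProfile x (∑ k, (τ k).edgesExcept (1, 0))

open Classical in
/-- The transition kernel of the profile process. Its value `PMF.pure 0` at the states `x` for which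
`nextProfileLaw ξ η x` conditions on a null event is arbitrary. -/
noncomputable def profileKernel (ξ : PMF ℕ) (η : (k : ℕ) → PMF (Fin k → ℤ)) (x : ℕ × ℕ × ℕ) :
    PMF (ℕ × ℕ × ℕ) :=
  if _ : IsProbabilityMeasure (nextProfileLaw ξ η x) then (nextProfileLaw ξ η x).toPMF
  else PMF.pure 0

theorem profileKernel_apply {x : ℕ × ℕ × ℕ} (hx : IsProbabilityMeasure (excursionLaw ξ η x.1 x.2.1))
    (y : ℕ × ℕ × ℕ) : profileKernel ξ η x y = excursionLaw ξ η x.1 x.2.1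
      {τ | nextProfile x (∑ k, (τ k).edgesExcept (1, 0)) = y} := by
  have hlaw : IsProbabilityMeasure (nextProfileLaw ξ η x) :=
    Measure.isProbabilityMeasure_map Measurable.of_discrete.aemeasurable
  rw [profileKernel, dif_pos hlaw, Measure.toPMF_apply, nextProfileLaw,
    Measure.map_apply .of_discrete .of_discrete]
  rfl

end ExcursionLaw

end LTree

section MarkovChain

variable {Ω S : Type*} {Y : ℕ → Ω → S} {m : ℕ}

/-- The events which are determined by the values of the process `Y` at the times `1, …, m`. -/
def IsPastEvent (Y : ℕ → Ω → S) (m : ℕ) (A : Set Ω) : Prop :=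
  ∀ ω ω', (∀ k, 1 ≤ k → k ≤ m → Y k ω = Y k ω') → ω ∈ A → ω' ∈ A

theorem isPastEvent_forall_eq (s : ℕ → S) :
    IsPastEvent Y m {ω | ∀ k, 1 ≤ k → k ≤ m → Y k ω = s k} :=
  fun _ _ h hω k hk hkm => (h k hk hkm).symm.trans (hω k hk hkm)

theorem isPastEvent_eq (hm : 1 ≤ m) (x : S) : IsPastEvent Y m {ω | Y m ω = x} :=
  fun _ _ h hω => (h m hm le_rfl).symm.trans hω

theorem IsPastEvent.inter_next_eq {A : Set Ω} (hA : IsPastEvent Y m A) (y : S) :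
    IsPastEvent Y (m + 1) (A ∩ {ω | Y (m + 1) ω = y}) :=
  fun _ _ h hω => ⟨hA _ _ (fun k hk hkm => h k hk (hkm.trans m.le_succ)) hω.1,
    (h _ (Nat.le_add_left 1 m) le_rfl).symm.trans hω.2⟩

variable [MeasurableSpace Ω] {μ : Measure Ω} {B : Set Ω} {h : S → ℝ≥0∞} {K : S → S → ℝ≥0∞}
  {x : S}

/-- Given the values of `Y` at the times `1, …, m`, the event `B` has conditional probability
`h (Y m)`. -/
def HasCondProbGivenPast (μ : Measure Ω) (Y : ℕ → Ω → S) (m : ℕ) (B : Set Ω)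
    (h : S → ℝ≥0∞) : Prop :=
  ∀ A, IsPastEvent Y m A → ∀ x, A ⊆ {ω | Y m ω = x} → μ (A ∩ B) = μ A * h x

theorem HasCondProbGivenPast.inter_next_eq
    (hK : ∀ y, HasCondProbGivenPast μ Y m {ω | Y (m + 1) ω = y} fun x => K x y)
    (hB : HasCondProbGivenPast μ Y (m + 1) B h) (y : S) :
    HasCondProbGivenPast μ Y m ({ω | Y (m + 1) ω = y} ∩ B) fun x => K x y * h y := by
  intro A hA x hAx
  rw [← Set.inter_assoc, hB _ (hA.inter_next_eq y) y Set.inter_subset_right, hK y A hA x hAx,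
    mul_assoc]

variable [DiscreteMeasurableSpace Ω]

theorem HasCondProbGivenPast.ne_zero_of_cond (hB : HasCondProbGivenPast μ Y m B h) {A : Set Ω}
    (hA : IsPastEvent Y m A) (hAx : A ⊆ {ω | Y m ω = x}) (h0 : μ[|B] A ≠ 0) : h x ≠ 0 := by
  rw [cond_apply .of_discrete, Set.inter_comm, hB A hA x hAx] at h0
  exact right_ne_zero_of_mul (right_ne_zero_of_mul h0)

variable [IsFiniteMeasure μ]

theorem HasCondProbGivenPast.cond_eq (hB : HasCondProbGivenPast μ Y m B h) {A : Set Ω}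
    (hA : IsPastEvent Y m A) (hAx : A ⊆ {ω | Y m ω = x}) (h0 : μ A ≠ 0) : μ[|A] B = h x := by
  rw [cond_apply .of_discrete, hB A hA x hAx, ← mul_assoc,
    ENNReal.inv_mul_cancel h0 (measure_ne_top _ _), one_mul]

theorem isMarkovChainWith_of_hasCondProbGivenPast (hK : ∀ m, 1 ≤ m → ∀ y,
    HasCondProbGivenPast μ Y m {ω | Y (m + 1) ω = y} fun x => K x y) :
    IsMarkovChainWith μ Y K :=
  fun m hm s hs y => (hK m hm y).cond_eq (isPastEvent_forall_eq s) (fun _ hω => hω m hm le_rfl) hs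

theorem HasCondProbGivenPast.tsum_mul_eq [Countable S] (hm : 1 ≤ m)
    (hK : ∀ y, HasCondProbGivenPast μ Y m {ω | Y (m + 1) ω = y} fun x => K x y)
    (hB : HasCondProbGivenPast μ Y m B h) (hB' : HasCondProbGivenPast μ Y (m + 1) B h)
    (hx : μ {ω | Y m ω = x} ≠ 0) : ∑' y, K x y * h y = h x := by
  have hpast := isPastEvent_eq (Y := Y) hm x
  refine (ENNReal.mul_right_inj hx (measure_ne_top _ _)).1 ?_
  calc μ {ω | Y m ω = x} * ∑' y, K x y * h y
    _ = ∑' y, μ ({ω | Y m ω = x} ∩ ({ω | Y (m + 1) ω = y} ∩ B)) := by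
      rw [← ENNReal.tsum_mul_left]
      exact tsum_congr fun y => (inter_next_eq hK hB' y _ hpast x subset_rfl).symm
    _ = μ ({ω | Y m ω = x} ∩ B) := by
      have hsum := measure_and_mem_eq_tsum μ ({ω | Y m ω = x} ∩ B) (Y (m + 1)) Set.univ
      rw [tsum_univ fun y => μ {ω | ω ∈ {ω | Y m ω = x} ∩ B ∧ Y (m + 1) ω = y}] at hsum
      simp only [Set.mem_univ, and_true, Set.ofPred_mem_eq] at hsum
      rw [hsum]
      exact tsum_congr fun y => congrArg μ (Set.ext fun ω => by
        simp only [Set.mem_inter_iff, Set.mem_ofPred_eq]; tauto)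
    _ = μ {ω | Y m ω = x} * h x := hB _ hpast x subset_rfl

theorem isMarkovChainWith_cond (hK : ∀ m, 1 ≤ m → ∀ y,
      HasCondProbGivenPast μ Y m {ω | Y (m + 1) ω = y} fun x => K x y)
    (hB : ∀ m, 1 ≤ m → HasCondProbGivenPast μ Y m B h) :
    IsMarkovChainWith (μ[|B]) Y fun x y => h y / h x * K x y := by
  intro m hm s hs y
  have hpast := isPastEvent_forall_eq (Y := Y) (m := m) s
  have hsub : {ω | ∀ k, 1 ≤ k → k ≤ m → Y k ω = s k} ⊆ {ω | Y m ω = s m} :=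
    fun _ hω => hω m hm le_rfl
  set A := {ω | ∀ k, 1 ≤ k → k ≤ m → Y k ω = s k}
  have hA : μ A ≠ 0 := fun h0 => hs (cond_absolutelyContinuous h0)
  have hBA := hB m hm A hpast (s m) hsub
  have hBAy := HasCondProbGivenPast.inter_next_eq (hK m hm) (hB _ (hm.trans m.le_succ)) y
    A hpast (s m) hsub
  rw [cond_cond_eq_cond_inter .of_discrete .of_discrete, cond_apply .of_discrete, Set.inter_comm B,
    Set.inter_right_comm, Set.inter_assoc, hBA, hBAy, mul_comm (μ A) (h (s m)),
    ENNReal.mul_inv (Or.inr (measure_ne_top _ _)) (Or.inr hA), mul_assoc,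
    ← mul_assoc _ (μ A), ENNReal.inv_mul_cancel hA (measure_ne_top _ _), one_mul]
  simp only [div_eq_mul_inv]
  ring

end MarkovChain

namespace LTree

section ProfileProcess

variable {ξ : PMF ℕ} {η : (k : ℕ) → PMF (Fin k → ℤ)}

theorem vertexProd_ne_zero_of_treeLaw_singleton {x : ℤ} {t : LTree}
    (ht : treeLaw ξ η x {t} ≠ 0) : t.vertexProd (childFactor ξ η) ≠ 0 := by
  classical
  contrapose! ht
  rw [treeLaw_apply, ENNReal.tsum_eq_zero]
  intro t'
  rw [ite_eq_right_iff]
  rintro ⟨-, rfl⟩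
  exact ht

variable {m : ℕ} {A B : Set LTree} {p q n : ℕ}

theorem mem_iff_of_isPastEvent_profile (hA : IsPastEvent profile m A)
    (hAx : A ⊆ {t | t.profile m = (p, q, n)}) (t : LTree) :
    t.shift (m - 1) ∈ A ↔ (t.edges.count (0, 1) = p ∧ t.edges.count (1, 0) = q) ∧
      t.edgesBelow ∈ edgesBelow '' (shift (m - 1) ⁻¹' A) := by
  have hprofile {t : LTree} (ht : t.shift (m - 1) ∈ A) : levelProfile 1 t.edges = (p, q, n) := by
    rw [← hAx ht, profile_shift, sub_sub_cancel]
  refine ⟨fun ht => ⟨(levelProfile_one_edges_eq_iff.1 (hprofile ht)).1, t, ht, rfl⟩, ?_⟩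
  rintro ⟨hpq, t', ht', hbelow⟩
  refine hA _ _ (fun k _ hkm => ?_) ht'
  rw [profile_shift, profile_shift]
  rcases hkm.eq_or_lt with rfl | hkm
  · have hn := (levelProfile_one_edges_eq_iff.1 (hprofile ht')).2
    rw [sub_sub_cancel, hprofile ht', levelProfile_one_edges_eq_iff.2 ⟨hpq, hbelow ▸ hn⟩]
  · rw [levelProfile_edges_of_nonpos (by omega), levelProfile_edges_of_nonpos (by omega), hbelow]

theorem treeLaw_inter_eq_mul_excursionLaw (hη : NearestNeighbour (childFactor ξ η))
    (hZ : treeLaw ξ η 0 Set.univ ≠ 0) (hm : 1 ≤ m) (hA : IsPastEvent profile m A)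
    (hAx : A ⊆ {t | t.profile m = (p, q, n)}) {Q : Set (Multiset (ℤ × ℤ))}
    (hB : ∀ t : LTree, t.vertexProd (childFactor ξ η) ≠ 0 → levelProfile 1 t.edges = (p, q, n) →
      (t.shift (m - 1) ∈ B ↔ t.edgesAbove ∈ Q)) :
    treeLaw ξ η 0 (A ∩ B) =
      treeLaw ξ η 0 A * excursionLaw ξ η p q {τ | ∑ k, (τ k).edgesExcept (1, 0) ∈ Q} := by
  have hshift (C : Set LTree) :
      treeLaw ξ η 0 C = treeLaw ξ η (1 - m) (shift (m - 1) ⁻¹' C) := by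
    rw [treeLaw_preimage_shift, sub_add_sub_cancel, sub_self]
  have hmem := mem_iff_of_isPastEvent_profile hA hAx
  have hA' : shift (m - 1) ⁻¹' A = {t : LTree | (t.edges.count (0, 1) = p ∧
      t.edges.count (1, 0) = q) ∧ t.edgesBelow ∈ edgesBelow '' (shift (m - 1) ⁻¹' A)} :=
    Set.ext hmem
  have hAB : treeLaw ξ η (1 - m) (shift (m - 1) ⁻¹' (A ∩ B)) =
      treeLaw ξ η (1 - m) {t | (t.edges.count (0, 1) = p ∧ t.edges.count (1, 0) = q) ∧
        t.edgesAbove ∈ Q ∧ t.edgesBelow ∈ edgesBelow '' (shift (m - 1) ⁻¹' A)} := by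
    refine measure_congr (ae_iff_of_countable.2 fun t ht => propext ?_)
    change t.shift (m - 1) ∈ A ∧ t.shift (m - 1) ∈ B ↔ _ ∧ _ ∧ _
    have hiff (ht' : t.shift (m - 1) ∈ A) := hB t (vertexProd_ne_zero_of_treeLaw_singleton ht) <| by
      rw [← hAx ht', profile_shift, sub_sub_cancel]
    have := hmem t
    tauto
  rw [hshift, hAB, treeLaw_eq_mul_excursionLaw hη hZ (by omega), ← hA', ← hshift]

theorem hasCondProbGivenPast_size (hη : NearestNeighbour (childFactor ξ η))
    (hZ : treeLaw ξ η 0 Set.univ ≠ 0) (hm : 1 ≤ m) (V : ℕ) :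
    HasCondProbGivenPast (treeLaw ξ η 0) profile m {t | t.size = V} (harmonicH ξ η V) := by
  rintro A hA ⟨p, q, n⟩ hAx
  rw [harmonicH_eq_excursionLaw hη]
  refine treeLaw_inter_eq_mul_excursionLaw hη hZ hm hA hAx
    (Q := {N | p + q + n + Multiset.card N = V}) fun t ht hx => ?_
  change (t.shift _).size = V ↔ p + q + n + Multiset.card t.edgesAbove = V
  rw [size_shift, hη.size_eq ht hx]

theorem isProbabilityMeasure_excursionLaw (hη : NearestNeighbour (childFactor ξ η))
    (hZ : treeLaw ξ η 0 Set.univ ≠ 0) (hm : 1 ≤ m) (hA : IsPastEvent profile m A)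
    (hAx : A ⊆ {t | t.profile m = (p, q, n)}) (h0 : treeLaw ξ η 0 A ≠ 0) :
    IsProbabilityMeasure (excursionLaw ξ η p q) := by
  have huniv := treeLaw_inter_eq_mul_excursionLaw hη hZ hm hA hAx (B := Set.univ) (Q := Set.univ)
    fun _ _ _ => Iff.rfl
  rw [Set.inter_univ] at huniv
  exact ⟨(ENNReal.mul_right_inj h0 (measure_ne_top _ _)).1 (huniv.symm.trans (mul_one _).symm)⟩

theorem hasCondProbGivenPast_profile_succ (hη : NearestNeighbour (childFactor ξ η))
    (hZ : treeLaw ξ η 0 Set.univ ≠ 0) (hm : 1 ≤ m) (y : ℕ × ℕ × ℕ) :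
    HasCondProbGivenPast (treeLaw ξ η 0) profile m {t | t.profile (m + 1) = y}
      fun x => profileKernel ξ η x y := by
  rintro A hA ⟨p, q, n⟩ hAx
  by_cases h0 : treeLaw ξ η 0 A = 0
  · rw [h0, zero_mul, measure_mono_null Set.inter_subset_left h0]
  beta_reduce
  rw [profileKernel_apply (isProbabilityMeasure_excursionLaw hη hZ hm hA hAx h0)]
  refine treeLaw_inter_eq_mul_excursionLaw hη hZ hm hA hAx
    (Q := {N | nextProfile (p, q, n) N = y}) fun t ht hx => ?_
  have hlevel : ((m + 1 : ℕ) : ℤ) - (m - 1) = 2 := by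
    push_cast
    ring
  change (t.shift _).profile (m + 1) = y ↔ nextProfile (p, q, n) t.edgesAbove = y
  rw [profile_shift, hlevel, ← hx, ← hη.levelProfile_two_edges ht]

end ProfileProcess

end LTree

theorem proposition4p5_general
    (ξ : PMF ℕ) (η : (k : ℕ) → PMF (Fin k → ℤ))
    (hη : ∀ (k : ℕ) (e : Fin k → ℤ), η k e ≠ 0 → ∀ i, e i = -1 ∨ e i = 0 ∨ e i = 1)
    (V : ℕ) (hZ : 0 < treeLaw ξ η 0 {t | t.size = V}) :
    ∃ P : ℕ × ℕ × ℕ → PMF (ℕ × ℕ × ℕ),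
      IsMarkovChainWith (treeLaw ξ η 0) LTree.profile (fun x y => P x y) ∧
      (∀ m : ℕ, 1 ≤ m → ∀ x, treeLaw ξ η 0 {t | t.profile m = x} ≠ 0 →
        harmonicH ξ η V x = (treeLaw ξ η 0)[|{t | t.profile m = x}] {t | t.size = V} ∧
        ∑' y, P x y * harmonicH ξ η V y = harmonicH ξ η V x) ∧
      (∀ m : ℕ, 1 ≤ m → ∀ x, sizedLaw ξ η V {t | t.profile m = x} ≠ 0 →
        harmonicH ξ η V x ≠ 0) ∧
      IsMarkovChainWith (sizedLaw ξ η V) LTree.profile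
        (fun x y => harmonicH ξ η V y / harmonicH ξ η V x * P x y) := by
  have hη' := LTree.nearestNeighbour_childFactor (ξ := ξ) hη
  have hZ' : treeLaw ξ η 0 Set.univ ≠ 0 := (hZ.trans_le (measure_mono (Set.subset_univ _))).ne'
  have hnext (m : ℕ) (hm : 1 ≤ m) := LTree.hasCondProbGivenPast_profile_succ hη' hZ' hm
  have hsize (m : ℕ) (hm : 1 ≤ m) := LTree.hasCondProbGivenPast_size hη' hZ' hm V
  refine ⟨LTree.profileKernel ξ η, isMarkovChainWith_of_hasCondProbGivenPast hnext,
    fun m hm x hx => ⟨?_, ?_⟩, fun m hm x hx => ?_, isMarkovChainWith_cond hnext hsize⟩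
  · exact ((hsize m hm).cond_eq (isPastEvent_eq hm x) subset_rfl hx).symm
  · exact (hsize m hm).tsum_mul_eq hm (hnext m hm) (hsize (m + 1) (hm.trans m.le_succ)) hx
  · exact (hsize m hm).ne_zero_of_cond (isPastEvent_eq hm x) subset_rfl hx

theorem proposition4p5
    (ξ : PMF ℕ) (hξ : ∑' k : ℕ, ξ k * (k : ℝ≥0∞) ≤ 1)
    (η : (k : ℕ) → PMF (Fin k → ℤ))
    (hη : ∀ (k : ℕ) (e : Fin k → ℤ), η k e ≠ 0 → ∀ i, e i = -1 ∨ e i = 0 ∨ e i = 1)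
    (V : ℕ) (hV : 1 ≤ V) (hZ : 0 < treeLaw ξ η 0 {t | t.size = V}) :
    ∃ P : ℕ × ℕ × ℕ → PMF (ℕ × ℕ × ℕ),
      -- `P` is the transition kernel of the process under the unconditioned law
      IsMarkovChainWith (treeLaw ξ η 0) LTree.profile (fun x y => P x y) ∧
      -- `H` is the conditional probability of having `V` edges, and is harmonic for `P`
      (∀ m : ℕ, 1 ≤ m → ∀ x, treeLaw ξ η 0 {t | t.profile m = x} ≠ 0 →
        harmonicH ξ η V x = (treeLaw ξ η 0)[|{t | t.profile m = x}] {t | t.size = V} ∧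
        ∑' y, P x y * harmonicH ξ η V y = harmonicH ξ η V x) ∧
      -- `H` does not vanish on the states visited under the conditioned law
      (∀ m : ℕ, 1 ≤ m → ∀ x, sizedLaw ξ η V {t | t.profile m = x} ≠ 0 →
        harmonicH ξ η V x ≠ 0) ∧
      -- under the conditioned law the process is a Markov chain, with the `h`-transformed kernel
      IsMarkovChainWith (sizedLaw ξ η V) LTree.profile
        (fun x y => harmonicH ξ η V y / harmonicH ξ η V x * P x y) :=
  proposition4p5_general ξ η hη V hZ
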